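/- Let $\varepsilon\ge 0$ and let $P,Q$ be probability measures on a measurable space $\mathcal X$. Let $p,q$ be densities of $P,Q$ with respect to a common dominating measure $\mu$, and put $\mathsf{TV}(P,Q)=\frac12\int|p-q|\,d\mu$, $H^2(P,Q)=\int(\sqrt p-\sqrt q)^2\,d\mu$, $\Upsilon_\varepsilon=\left(\frac{e^\varepsilon-1}{e^\varepsilon+1}\right)^2$ and $\Psi_\varepsilon=e^{-\varepsilon}(e^\varepsilon-1)^2$. A mechanism from $\mathcal X$ to a measurable space $\mathcal Z$ is a Markov kernel $\mathsf K$ from $\mathcal X$ to $\mathcal Z$. It is $\varepsilon$-locally differentially private ($\varepsilon$-LDP) if $\mathsf K(A\mid x)\le e^\varepsilon\,\mathsf K(A\mid x')$ for all measurable $A\subseteq\mathcal Z$ and all $x,x'\in\mathcal X$. Write $P\mathsf K(A)=\int \mathsf K(A\mid x)\,dP(x)$. Given mechanisms $\mathsf K_1,\mathsf K_2,\dots$ from $\mathcal X$ to $\mathcal Z$ (applied non-interactively, $Z_i$ being drawn from $\mathsf K_i(\cdot\mid X_i)$ with $X_1,\dots,X_n$ i.i.d.), the privatized sample $Z^n$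 has law $\bigotimes_{i\le n}P\mathsf K_i$ under $H_0=P$ and $\bigotimes_{i\le n}Q\mathsf K_i$ under $H_1=Q$. For a test $\phi$, that is, a sequence of measurable maps $\phi_n:\mathcal Z^n\to\{0,1\}$, let $n^*(\phi)$ be the least $N$ such that for every $n\ge N$ $$\Big(\bigotimes_{i\le n}P\mathsf K_i\Big)(\phi_n=1)<\tfrac1{10}\quad\text{and}\quad 1-\Big(\bigotimes_{i\le n}Q\mathsf K_i\Big)(\phi_n=1)<\tfrac1{10},$$ and $n^*(\phi)=\infty$ if there is no such $N$. The sample complexity $\mathsf{SC}^{P,Q}_\varepsilon$ of non-interactively $\varepsilon$-LDP distinguishing $P$ from $Q$ is the infimum of $n^*(\phi)$ over all output spaces $\mathcal Z$, all sequences $\mathsf K_1,\mathsf K_2,\dots$ of $\varepsilon$-LDP mechanisms from $\mathcal X$ to $\mathcal Z$, and all tests $\phi$ ($\inf\emptyset=\infty$). Then $$\max\left\{\frac{\log(2.5)}{4\Upsilon_\varepsilon H^2(P,Q)},\ \frac{2}{25\,\Psi_\varepsilon\mathsf{TV}^2(P,Q)}\right\}\ \le\ \mathsf{SC}^{P,Q}_\varepsilon\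 \le\ \frac{2\log 5}{\Upsilon_\varepsilon\mathsf{TV}^2(P,Q)},$$ where $\log$ is the natural logarithm and $c/0=\infty$ for $c>0$. The same two bounds hold for the sample complexity in which all mechanisms are required to be equal, $\mathsf K_i=\mathsf K$ for all $i$. -/

import Mathlib

open MeasureTheory ProbabilityTheory
open scoped ENNReal

universe u v

namespace LDP

/-- The constant `Υ_ε = ((e^ε - 1) / (e^ε + 1))²`. -/
noncomputable def Upsilon (ε : ℝ) : ℝ := ((Real.exp ε - 1) / (Real.exp ε + 1)) ^ 2

/-- The constant `Ψ_ε = e^{-ε} (e^ε - 1)²`. -/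
noncomputable def Psi (ε : ℝ) : ℝ := Real.exp (-ε) * (Real.exp ε - 1) ^ 2

/-- Total variation distance `TV(P, Q) = (1/2) ∫ |p - q| dμ`, where `p`, `q` are the densities of
`P`, `Q` with respect to `μ = P + Q`. It takes values in `[0, 1]` for probability measures. If
`P ≪ Q`, this is the `f`-divergence `E_Q[f(dP/dQ)]` with `f(t) = |t - 1| / 2`. -/
noncomputable def tvDist {X : Type u} [MeasurableSpace X] (P Q : Measure X) : ℝ :=
  (1 / 2) * ∫ x, |(P.rnDeriv (P + Q) x).toReal - (Q.rnDeriv (P + Q) x).toReal| ∂(P + Q)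

/-- Squared Hellinger distance `H²(P, Q) = ∫ (√p - √q)² dμ` (no factor `1/2`), where `p`, `q` are
the densities of `P`, `Q` with respect to `μ = P + Q`. It takes values in `[0, 2]` for probability
measures. If `P ≪ Q`, this is the `f`-divergence `E_Q[f(dP/dQ)]` with `f(t) = (1 - √t)²`. -/
noncomputable def hellingerSq {X : Type u} [MeasurableSpace X] (P Q : Measure X) : ℝ :=
  ∫ x, (Real.sqrt (P.rnDeriv (P + Q) x).toReal - Real.sqrt (Q.rnDeriv (P + Q) x).toReal) ^ 2
    ∂(P + Q)

/-- A mechanism from `X` to `Z` is a Markov kernel `K`. It is `ε`-locally differentially private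
if `K(A | x) ≤ e^ε K(A | x')` for all events `A` and all inputs `x`, `x'`. -/
structure IsLDPMechanism {X : Type u} {Z : Type v} [MeasurableSpace X] [MeasurableSpace Z]
    (ε : ℝ) (K : Kernel X Z) : Prop where
  isMarkov : IsMarkovKernel K
  ldp : ∀ A : Set Z, MeasurableSet A → ∀ x x' : X,
    K x A ≤ ENNReal.ofReal (Real.exp ε) * K x' A

/-- The law of the privatized sample `Z^n` when `X_1, …, X_n` are i.i.d. with law `P` and
`Z_i` is produced from `X_i` alone by the mechanism `K i`: the product of the output laws
`P (K i)`, `P (K i) (A) = ∫ K i (A | x) dP(x)`. -/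
noncomputable def outputLaw {X : Type u} {Z : Type v} [MeasurableSpace X] [MeasurableSpace Z]
    (P : Measure X) (K : ℕ → Kernel X Z) (n : ℕ) : Measure (Fin n → Z) :=
  Measure.pi fun i : Fin n => P.bind (K i)

/-- Both error probabilities of the test `φ` (`true` means that the null hypothesis `P` is
rejected) based on `n` privatized observations are smaller than `1/10`. -/
def ErrorsSmall {X : Type u} {Z : Type v} [MeasurableSpace X] [MeasurableSpace Z]
    (P Q : Measure X) (K : ℕ → Kernel X Z) (n : ℕ) (φ : (Fin n → Z) → Bool) : Prop :=
  (outputLaw P K n).real {z | φ z = true} < 1 / 10 ∧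
    1 - (outputLaw Q K n).real {z | φ z = true} < 1 / 10

/-- The sample complexity `n*(φ)` of a test `φ = (φ_n)_n` with mechanisms `K`: the least `N` such
that both error probabilities are smaller than `1/10` for every `n ≥ N`
(it is `∞` if there is no such `N`). -/
noncomputable def testSampleComplexity {X : Type u} {Z : Type v}
    [MeasurableSpace X] [MeasurableSpace Z]
    (P Q : Measure X) (K : ℕ → Kernel X Z) (φ : (n : ℕ) → (Fin n → Z) → Bool) : ℕ∞ :=
  ⨅ (N : ℕ) (_ : ∀ n : ℕ, N ≤ n → ErrorsSmall P Q K n (φ n)), (N : ℕ∞)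

/-- The sample complexity of non-interactively `ε`-LDP distinguishing `P` from `Q`: the infimum of
`n*(φ)` over all output spaces, all sequences of `ε`-LDP mechanisms, and all (measurable) tests. -/
noncomputable def sampleComplexity {X : Type u} [MeasurableSpace X]
    (ε : ℝ) (P Q : Measure X) : ℕ∞ :=
  ⨅ (Z : Type v) (_ : MeasurableSpace Z) (K : ℕ → Kernel X Z) (_ : ∀ i, IsLDPMechanism ε (K i))
    (φ : (n : ℕ) → (Fin n → Z) → Bool) (_ : ∀ n, Measurable (φ n)),
    testSampleComplexity P Q K φ

/-- The same, when all samples are privatized by copies of one common `ε`-LDP mechanism. -/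
noncomputable def commonSampleComplexity {X : Type u} [MeasurableSpace X]
    (ε : ℝ) (P Q : Measure X) : ℕ∞ :=
  ⨅ (Z : Type v) (_ : MeasurableSpace Z) (K : Kernel X Z) (_ : IsLDPMechanism ε K)
    (φ : (n : ℕ) → (Fin n → Z) → Bool) (_ : ∀ n, Measurable (φ n)),
    testSampleComplexity P Q (fun _ => K) φ

/-- The lower bound `max {log 2.5 / (4 Υ_ε H²(P,Q)), 2 / (25 Ψ_ε TV²(P,Q))}`, in `[0, ∞]`,
where `c / 0 = ∞` for `c > 0`. -/
noncomputable def lowerBound {X : Type u} [MeasurableSpace X] (ε : ℝ) (P Q : Measure X) : ℝ≥0∞ :=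
  max (ENNReal.ofReal (Real.log 2.5) / ENNReal.ofReal (4 * Upsilon ε * hellingerSq P Q))
    (2 / ENNReal.ofReal (25 * Psi ε * tvDist P Q ^ 2))

/-- The upper bound `2 log 5 / (Υ_ε TV²(P,Q))`, in `[0, ∞]`, where `c / 0 = ∞` for `c > 0`. -/
noncomputable def upperBound {X : Type u} [MeasurableSpace X] (ε : ℝ) (P Q : Measure X) : ℝ≥0∞ :=
  ENNReal.ofReal (2 * Real.log 5) / ENNReal.ofReal (Upsilon ε * tvDist P Q ^ 2)

end LDP

/-! Lower bound. Two errors below 1/10 force the Hellinger affinity of the two laws of the sample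
below 3/5. Affinity is multiplicative over products, and each factor is at least `1 - L / 2`, where
`L` is the triangular discrimination of one pair of output laws; Bernoulli's inequality then gives
`n * L ≥ 4 / 5` for every common upper bound `L`. So everything rests on bounding `L` by privacy,
which `IsLDPMechanism.exists_output_density` does: for `f = (dPK - dQK) / d(PK + QK)` one has `L = ∫
f² d(PK + QK) = ∫ F d(P - Q)` with `F x = ∫ f dK(x)`. The Hellinger bound follows from
Cauchy–Schwarz and the contraction `IsLDPMechanism.integral_sq_le`, the total variation bound from
the uniform oscillation estimate `IsLDPMechanism.sq_sub_le`. Both rest on one estimate for two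
measures with likelihood ratio in `[e^{-ε}, e^ε]`, `sq_integral_sub_integral_le`.

Upper bound. Randomized response to an event attaining `TV` yields output laws whose probabilities
of one event differ by `√Υ * TV`, so the squared affinity of one output is at most `1 - s` with `s =
Υ * TV²`. The posterior randomized test has both errors at most half the affinity of the sample,
hence succeeds once `(1 - s) ^ n < 1 / 25`. Its coin is supplied by a uniform variable, independent
of the data, appended to each private output. One mechanism serves for all observations, so the same
argument covers the common-mechanism version. -/

namespace LDP

/-! ### Cauchy–Schwarz, densities with respect to `P + Q`, and integration against `P.bind K`. -/

section Basics

variable {Ω : Type*} [MeasurableSpace Ω]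

lemma integrable_of_abs_le {μ : Measure Ω} [IsFiniteMeasure μ] {f : Ω → ℝ} (hf : Measurable f)
    {C : ℝ} (hC : ∀ x, |f x| ≤ C) : Integrable f μ :=
  Integrable.of_bound hf.aestronglyMeasurable C (Filter.Eventually.of_forall hC)

/-- Discriminant form of Cauchy–Schwarz: it needs only the pointwise inequality between integrands
for each `t`, and no division by `N`. -/
lemma sq_le_mul_of_forall_two_mul_le {N D V : ℝ} (h : ∀ t : ℝ, 2 * t * D ≤ t ^ 2 * N + V) :
    D ^ 2 ≤ N * V := by
  have := discrim_le_zero (a := N) (b := -2 * D) (c := V) (fun t => by nlinarith [h t])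
  rw [discrim] at this
  nlinarith

lemma sq_integral_mul_le {μ : Measure Ω} {f g : Ω → ℝ} (hf : Integrable (fun x => f x ^ 2) μ)
    (hg : Integrable (fun x => g x ^ 2) μ) (hfg : Integrable (fun x => f x * g x) μ) :
    (∫ x, f x * g x ∂μ) ^ 2 ≤ (∫ x, f x ^ 2 ∂μ) * ∫ x, g x ^ 2 ∂μ := by
  refine sq_le_mul_of_forall_two_mul_le fun t => ?_
  rw [← integral_const_mul, ← integral_const_mul, ← integral_add (hf.const_mul _) hg]
  refine integral_mono (hfg.const_mul _) ((hf.const_mul _).add hg) fun x => ?_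
  simp only
  nlinarith [sq_nonneg (t * f x - g x)]

lemma integral_withDensity_ofReal {ν : Measure Ω} {r : Ω → ℝ} (hr : Measurable r)
    (hr0 : ∀ x, 0 ≤ r x) (f : Ω → ℝ) :
    ∫ x, f x ∂(ν.withDensity fun x => ENNReal.ofReal (r x)) = ∫ x, r x * f x ∂ν := by
  rw [integral_withDensity_eq_integral_toReal_smul hr.ennreal_ofReal (by simp)]
  simp [ENNReal.toReal_ofReal (hr0 _)]

/-- With respect to `P + Q`, the measures `P` and `Q` have densities `p` and `1 - p` with values
in `[0, 1]`. -/
lemma exists_density (P Q : Measure Ω) [IsFiniteMeasure P] [IsFiniteMeasure Q] :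
    ∃ p : Ω → ℝ, Measurable p ∧ (∀ x, 0 ≤ p x) ∧ (∀ x, p x ≤ 1) ∧
      P = (P + Q).withDensity (fun x => ENNReal.ofReal (p x)) ∧
      Q = (P + Q).withDensity (fun x => ENNReal.ofReal (1 - p x)) ∧
      (∀ᵐ x ∂(P + Q), (P.rnDeriv (P + Q) x).toReal = p x) ∧
      (∀ᵐ x ∂(P + Q), (Q.rnDeriv (P + Q) x).toReal = 1 - p x) := by
  have hP : P ≪ P + Q := Measure.absolutelyContinuous_of_le (Measure.le_add_right le_rfl)
  have hQ : Q ≪ P + Q := Measure.absolutelyContinuous_of_le (Measure.le_add_left le_rfl)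
  have hsum : ∀ᵐ x ∂(P + Q), P.rnDeriv (P + Q) x + Q.rnDeriv (P + Q) x = 1 := by
    filter_upwards [Measure.rnDeriv_add' P Q (P + Q), Measure.rnDeriv_self (P + Q)] with x h1 h2
    rw [h2] at h1
    exact h1.symm
  have hsum' : ∀ᵐ x ∂(P + Q), (P.rnDeriv (P + Q) x).toReal + (Q.rnDeriv (P + Q) x).toReal = 1 := by
    filter_upwards [hsum] with x h
    have h1 : P.rnDeriv (P + Q) x ≠ ∞ := fun h' => by simp [h'] at h
    have h2 : Q.rnDeriv (P + Q) x ≠ ∞ := fun h' => by simp [h'] at h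
    rw [← ENNReal.toReal_add h1 h2, h, ENNReal.toReal_one]
  have hp : ∀ᵐ x ∂(P + Q), (P.rnDeriv (P + Q) x).toReal
      = min (P.rnDeriv (P + Q) x).toReal 1 := by
    filter_upwards [hsum'] with x h
    rw [min_eq_left]
    linarith [ENNReal.toReal_nonneg (a := Q.rnDeriv (P + Q) x)]
  have hq : ∀ᵐ x ∂(P + Q), (Q.rnDeriv (P + Q) x).toReal
      = 1 - min (P.rnDeriv (P + Q) x).toReal 1 := by
    filter_upwards [hsum', hp] with x h h'
    rw [← h']
    linarith
  -- Truncation at 1 changes nothing almost everywhere, but makes `0 ≤ p ≤ 1` hold at every point.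
  refine ⟨fun x => min (P.rnDeriv (P + Q) x).toReal 1, by fun_prop,
    fun x => le_min ENNReal.toReal_nonneg zero_le_one, fun x => min_le_right _ _, ?_, ?_, hp, hq⟩
  · conv_lhs => rw [← Measure.withDensity_rnDeriv_eq P (P + Q) hP]
    refine withDensity_congr_ae ?_
    filter_upwards [hp, Measure.rnDeriv_lt_top P (P + Q)] with x h h'
    rw [← h, ENNReal.ofReal_toReal h'.ne]
  · conv_lhs => rw [← Measure.withDensity_rnDeriv_eq Q (P + Q) hQ]
    refine withDensity_congr_ae ?_
    filter_upwards [hq, Measure.rnDeriv_lt_top Q (P + Q)] with x h h'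
    rw [← h, ENNReal.ofReal_toReal h'.ne]

lemma le_density_mul_of_le {a b : Measure Ω} [IsFiniteMeasure a] [IsFiniteMeasure b] {y : ℝ}
    (h : ∀ A, MeasurableSet A → a A ≤ ENNReal.ofReal y * b A) {ν : Measure Ω} [IsFiniteMeasure ν]
    {p q : Ω → ℝ} (hpm : Measurable p) (hqm : Measurable q) (hq0 : ∀ x, 0 ≤ q x)
    (ha : a = ν.withDensity fun x => ENNReal.ofReal (p x))
    (hb : b = ν.withDensity fun x => ENNReal.ofReal (q x)) (hy : 0 ≤ y) :
    ∀ᵐ x ∂ν, p x ≤ y * q x := by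
  have : (fun x => ENNReal.ofReal (p x)) ≤ᵐ[ν] fun x => ENNReal.ofReal (y * q x) := by
    refine ae_le_of_forall_setLIntegral_le_of_sigmaFinite hpm.ennreal_ofReal fun s hs _ => ?_
    have := h s hs
    rw [ha, hb, withDensity_apply _ hs, withDensity_apply _ hs,
      ← lintegral_const_mul _ hqm.ennreal_ofReal] at this
    simpa [ENNReal.ofReal_mul hy] using this
  filter_upwards [this] with x hx
  exact (ENNReal.ofReal_le_ofReal_iff (mul_nonneg hy (hq0 x))).1 hx

lemma integral_bind_kernel {Z : Type*} [MeasurableSpace Z] (P : Measure Ω) [IsFiniteMeasure P]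
    (K : Kernel Ω Z) [IsMarkovKernel K] {f : Z → ℝ} (hf : Measurable f) {C : ℝ}
    (hC : ∀ z, |f z| ≤ C) : ∫ z, f z ∂(P.bind K) = ∫ x, ∫ z, f z ∂(K x) ∂P := by
  have h := Kernel.integral_comp (κ := Kernel.const Unit P) (η := K) (a := ()) (f := f)
    (integrable_of_abs_le hf hC)
  simpa [Kernel.comp_apply] using h

end Basics

/-! ### Contraction of second moments by locally private mechanisms. -/

section Contraction

/-- Put `r = (2p - 1) / w` with `w = αp + β(1 - p)`. As `p / (1 - p)` runs over `[y⁻¹, y]`, `r` runs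
over `[-L, U]`, with `U` and `L` the two fractions in the bound. Hence `(U - r)(r + L) ≥ 0`, which
bounds `r²` by an affine function of `r`. Multiplying by `w` and using `2tf(2p - 1) ≤ t²f²w + (2p -
1)² / w` gives the claim. The last term is a multiple of `2p - 1`, so it integrates to zero. -/
lemma density_pair_bound {y α β p : ℝ} (hp0 : 0 < p) (hp1 : 0 < 1 - p)
    (h1 : p ≤ y * (1 - p)) (h2 : 1 - p ≤ y * p) (hα : 0 ≤ α) (hβ : 0 ≤ β) (hαβ : 0 < α + β)
    (hy : 1 ≤ y) (t f : ℝ) :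
    2 * t * (f * (2 * p - 1)) ≤ t ^ 2 * (f ^ 2 * (α * p + β * (1 - p))) +
      ((y - 1) / (α * y + β) * ((y - 1) / (α + β * y)) * (α * p + β * (1 - p)) +
        ((y - 1) / (α * y + β) - (y - 1) / (α + β * y)) * (2 * p - 1)) := by
  have hd1 : 0 < α * y + β := by linarith [mul_le_mul_of_nonneg_left hy hα]
  have hd2 : 0 < α + β * y := by nlinarith
  set w := α * p + β * (1 - p) with hw
  have hw0 : 0 < w := by
    rcases hα.eq_or_lt with h | h
    · have : 0 < β := by linarith
      rw [hw, ← h]; nlinarith [mul_pos this hp1]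
    · nlinarith [mul_pos h hp0, mul_nonneg hβ hp1.le]
  set U := (y - 1) / (α * y + β) with hU
  set L := (y - 1) / (α + β * y) with hL
  have e1 : 0 ≤ U * w - (2 * p - 1) := by
    have : U * w - (2 * p - 1) = (α + β) * (y * (1 - p) - p) / (α * y + β) := by
      rw [hU, hw, div_mul_eq_mul_div, eq_div_iff hd1.ne', sub_mul, div_mul_cancel₀ _ hd1.ne']
      ring
    rw [this]
    exact div_nonneg (mul_nonneg hαβ.le (by linarith)) hd1.le
  have e2 : 0 ≤ (2 * p - 1) + L * w := by
    have : (2 * p - 1) + L * w = (α + β) * (y * p - (1 - p)) / (α + β * y) := by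
      rw [hL, hw, div_mul_eq_mul_div, eq_div_iff hd2.ne', add_mul, div_mul_cancel₀ _ hd2.ne']
      ring
    rw [this]
    exact div_nonneg (mul_nonneg hαβ.le (by linarith)) hd2.le
  have e3 := mul_nonneg e1 e2
  have e4 := sq_nonneg (t * f * w - (2 * p - 1))
  refine le_of_mul_le_mul_left ?_ hw0
  nlinarith

/-- If two probability measures `a`, `b` have likelihood ratio in `[y⁻¹, y]`, then integrals of the
same function differ little, relative to any combination of the second moments. -/
lemma sq_integral_sub_integral_le {Z : Type*} [MeasurableSpace Z] {a b : Measure Z}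
    [IsProbabilityMeasure a] [IsProbabilityMeasure b] {y : ℝ} (hy : 1 ≤ y)
    (hab : ∀ A, MeasurableSet A → a A ≤ ENNReal.ofReal y * b A)
    (hba : ∀ A, MeasurableSet A → b A ≤ ENNReal.ofReal y * a A)
    {f : Z → ℝ} (hf : Measurable f) {C : ℝ} (hC : ∀ z, |f z| ≤ C)
    {α β : ℝ} (hα : 0 ≤ α) (hβ : 0 ≤ β) (hαβ : 0 < α + β) :
    ((∫ z, f z ∂a) - ∫ z, f z ∂b) ^ 2 ≤
      (α * (∫ z, f z ^ 2 ∂a) + β * ∫ z, f z ^ 2 ∂b) *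
        ((y - 1) / (α * y + β) * ((y - 1) / (α + β * y)) * (α + β)) := by
  obtain ⟨p, hpm, hp0, hp1, ha, hb, -, -⟩ := exists_density a b
  set ν := a + b with hν
  have hq0 : ∀ x, 0 ≤ 1 - p x := fun x => by linarith [hp1 x]
  have hqm : Measurable fun x => 1 - p x := by fun_prop
  have r1 := le_density_mul_of_le hab hpm hqm hq0 ha hb (by linarith)
  have r2 := le_density_mul_of_le hba hqm hpm hp0 hb ha (by linarith)
  have ia : ∀ g : Z → ℝ, ∫ z, g z ∂a = ∫ z, p z * g z ∂ν := fun g => by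
    conv_lhs => rw [ha]
    exact integral_withDensity_ofReal hpm hp0 g
  have ib : ∀ g : Z → ℝ, ∫ z, g z ∂b = ∫ z, (1 - p z) * g z ∂ν := fun g => by
    conv_lhs => rw [hb]
    exact integral_withDensity_ofReal hqm hq0 g
  have hC2 : ∀ z, f z ^ 2 ≤ C ^ 2 := fun z => sq_le_sq' (abs_le.1 (hC z)).1 (abs_le.1 (hC z)).2
  have abs_p : ∀ z, |p z| ≤ 1 := fun z => abs_le.2 ⟨by linarith [hp0 z], hp1 z⟩
  have abs_q : ∀ z, |1 - p z| ≤ 1 := fun z => abs_le.2 ⟨by linarith [hp1 z], by linarith [hp0 z]⟩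
  have mul_bd : ∀ {r g c : ℝ}, |r| ≤ 1 → |g| ≤ c → |r * g| ≤ c := fun {r g c} h1 h2 => by
    rw [abs_mul]
    nlinarith [abs_nonneg r, abs_nonneg g]
  have i1 : Integrable (fun z => p z * f z) ν :=
    integrable_of_abs_le (by fun_prop) fun z => mul_bd (abs_p z) (hC z)
  have i2 : Integrable (fun z => (1 - p z) * f z) ν :=
    integrable_of_abs_le (by fun_prop) fun z => mul_bd (abs_q z) (hC z)
  have hC2' : ∀ z, |f z ^ 2| ≤ C ^ 2 := fun z => by rw [abs_of_nonneg (sq_nonneg _)]; exact hC2 z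
  have i3 : Integrable (fun z => p z * f z ^ 2) ν :=
    integrable_of_abs_le (by fun_prop) fun z => mul_bd (abs_p z) (hC2' z)
  have i4 : Integrable (fun z => (1 - p z) * f z ^ 2) ν :=
    integrable_of_abs_le (by fun_prop) fun z => mul_bd (abs_q z) (hC2' z)
  have i5 : Integrable p ν := integrable_of_abs_le hpm abs_p
  have i6 : Integrable (fun z => 1 - p z) ν := integrable_of_abs_le hqm abs_q
  have j5 : ∫ z, p z ∂ν = 1 := by simpa using (ia fun _ => 1).symm
  have j6 : ∫ z, (1 - p z) ∂ν = 1 := by simpa using (ib fun _ => 1).symm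
  set U := (y - 1) / (α * y + β)
  set L := (y - 1) / (α + β * y)
  rw [ia, ib, ia, ib]
  refine sq_le_mul_of_forall_two_mul_le fun t => ?_
  have lhs : 2 * t * ((∫ z, p z * f z ∂ν) - ∫ z, (1 - p z) * f z ∂ν) =
      ∫ z, 2 * t * (p z * f z - (1 - p z) * f z) ∂ν := by
    rw [integral_const_mul, integral_sub i1 i2]
  have k1 : Integrable
      (fun z => t ^ 2 * (α * (p z * f z ^ 2) + β * ((1 - p z) * f z ^ 2))) ν :=
    ((i3.const_mul _).add (i4.const_mul _)).const_mul _
  -- The affine bound is regrouped in `p` and `1 - p`. Both have integral 1, so the `U - L`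
  -- contributions cancel and `U * L * (α + β)` remains.
  have k2 : Integrable (fun z => (U * L * α + (U - L)) * p z +
      (U * L * β - (U - L)) * (1 - p z)) ν := (i5.const_mul _).add (i6.const_mul _)
  have rhs : t ^ 2 * (α * (∫ z, p z * f z ^ 2 ∂ν) + β * ∫ z, (1 - p z) * f z ^ 2 ∂ν)
      + U * L * (α + β) =
      ∫ z, (t ^ 2 * (α * (p z * f z ^ 2) + β * ((1 - p z) * f z ^ 2)) +
        ((U * L * α + (U - L)) * p z + (U * L * β - (U - L)) * (1 - p z))) ∂ν := by
    rw [integral_add k1 k2, integral_const_mul,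
      integral_add (i3.const_mul _) (i4.const_mul _), integral_add (i5.const_mul _) (i6.const_mul _)]
    simp only [integral_const_mul, j5, j6]
    ring
  rw [lhs, rhs]
  refine integral_mono_ae ((i1.sub i2).const_mul _) (k1.add k2) ?_
  filter_upwards [r1, r2] with z h1 h2
  have h3 : 0 < p z := by nlinarith [hp0 z, hp1 z]
  have h4 : 0 < 1 - p z := by nlinarith [hp0 z, hp1 z]
  have := density_pair_bound h3 h4 h1 h2 hα hβ hαβ hy t (f z)
  linear_combination this

/-- The denominators satisfy `(αy + β)(α + βy) - αβ(y + 1)² = y(α - β)²`, so equal weights are the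
worst case; this is where `Υ` comes from. -/
lemma weight_bound {y α β : ℝ} (hy : 1 ≤ y) (hα : 0 ≤ α) (hβ : 0 ≤ β) (hαβ : 0 < α + β) :
    α * β * ((y - 1) / (α * y + β) * ((y - 1) / (α + β * y)) * (α + β)) ≤
      ((y - 1) / (y + 1)) ^ 2 * (α + β) := by
  have hd1 : 0 < α * y + β := by linarith [mul_le_mul_of_nonneg_left hy hα]
  have hd2 : 0 < α + β * y := by nlinarith
  have key : α * β * (y + 1) ^ 2 ≤ (α * y + β) * (α + β * y) := by
    nlinarith [mul_nonneg (by linarith : 0 ≤ y) (sq_nonneg (α - β))]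
  have e : α * β * ((y - 1) / (α * y + β) * ((y - 1) / (α + β * y)) * (α + β))
      = (y - 1) ^ 2 * (α + β) * (α * β / ((α * y + β) * (α + β * y))) := by
    field_simp
  have e' : ((y - 1) / (y + 1)) ^ 2 * (α + β) = (y - 1) ^ 2 * (α + β) * (1 / (y + 1) ^ 2) := by
    field_simp
  rw [e, e']
  refine mul_le_mul_of_nonneg_left ?_ (by positivity)
  rw [div_le_div_iff₀ (by positivity) (by positivity)]
  linarith

lemma Upsilon_nonneg (ε : ℝ) : 0 ≤ Upsilon ε := sq_nonneg _

lemma Psi_nonneg (ε : ℝ) : 0 ≤ Psi ε := mul_nonneg (Real.exp_pos _).le (sq_nonneg _)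

variable {X Z : Type*} [MeasurableSpace X] [MeasurableSpace Z]

lemma IsLDPMechanism.mul_sq_sub_le {ε : ℝ} (hε : 0 ≤ ε) {K : Kernel X Z}
    (hK : IsLDPMechanism ε K) {f : Z → ℝ} (hf : Measurable f) {C : ℝ} (hC : ∀ z, |f z| ≤ C)
    (x x' : X) {α β : ℝ} (hα : 0 ≤ α) (hβ : 0 ≤ β) (hαβ : 0 < α + β) :
    α * β * ((∫ z, f z ∂(K x)) - ∫ z, f z ∂(K x')) ^ 2 ≤
      Upsilon ε * (α + β) * (α * (∫ z, f z ^ 2 ∂(K x)) + β * ∫ z, f z ^ 2 ∂(K x')) := by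
  have := hK.isMarkov
  have hy : 1 ≤ Real.exp ε := Real.one_le_exp hε
  have h := sq_integral_sub_integral_le hy (fun A hA => hK.ldp A hA x x')
    (fun A hA => hK.ldp A hA x' x) hf hC hα hβ hαβ
  have h2 := weight_bound hy hα hβ hαβ
  have hN : 0 ≤ α * (∫ z, f z ^ 2 ∂(K x)) + β * ∫ z, f z ^ 2 ∂(K x') :=
    add_nonneg (mul_nonneg hα (integral_nonneg fun _ => sq_nonneg _))
      (mul_nonneg hβ (integral_nonneg fun _ => sq_nonneg _))
  rw [Upsilon]
  nlinarith [mul_le_mul_of_nonneg_left h (mul_nonneg hα hβ), mul_le_mul_of_nonneg_left h2 hN]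

/-- The weights `α = 0`, `β = 1` turn the general constant into `(y - 1)² / y = Ψ`. -/
lemma IsLDPMechanism.sq_sub_le {ε : ℝ} (hε : 0 ≤ ε) {K : Kernel X Z}
    (hK : IsLDPMechanism ε K) {f : Z → ℝ} (hf : Measurable f) {C : ℝ} (hC : ∀ z, |f z| ≤ C)
    (x x' : X) :
    ((∫ z, f z ∂(K x)) - ∫ z, f z ∂(K x')) ^ 2 ≤ Psi ε * ∫ z, f z ^ 2 ∂(K x') := by
  have := hK.isMarkov
  have hy : 1 ≤ Real.exp ε := Real.one_le_exp hε
  have h := sq_integral_sub_integral_le hy (fun A hA => hK.ldp A hA x x')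
    (fun A hA => hK.ldp A hA x' x) hf hC le_rfl zero_le_one (by norm_num)
  refine h.trans (le_of_eq ?_)
  rw [Psi, Real.exp_neg]
  field_simp
  ring

/-- The `χ²`-contraction of an `ε`-LDP mechanism, in its dual form: the operator
`f ↦ (x ↦ ∫ f dK(x))` shrinks the second moment of centered functions by the factor `Υ_ε`. -/
lemma IsLDPMechanism.integral_sq_le {ε : ℝ} (hε : 0 ≤ ε) {K : Kernel X Z}
    (hK : IsLDPMechanism ε K) {f : Z → ℝ} (hf : Measurable f) {C : ℝ} (hC : ∀ z, |f z| ≤ C)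
    (μ : Measure X) [IsFiniteMeasure μ] (h0 : ∫ x, ∫ z, f z ∂(K x) ∂μ = 0) :
    ∫ x, (∫ z, f z ∂(K x)) ^ 2 ∂μ ≤ Upsilon ε * ∫ x, ∫ z, f z ^ 2 ∂(K x) ∂μ := by
  have := hK.isMarkov
  set F : X → ℝ := fun x => ∫ z, f z ∂(K x) with hF
  set F₂ : X → ℝ := fun x => ∫ z, f z ^ 2 ∂(K x) with hF₂
  have hFm : Measurable F := (hf.stronglyMeasurable.integral_kernel (κ := K)).measurable
  have hF₂m : Measurable F₂ :=
    ((hf.pow_const 2).stronglyMeasurable.integral_kernel (κ := K)).measurable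
  have hFC : ∀ x, |F x| ≤ C := fun x => by
    have := norm_integral_le_of_norm_le_const (μ := K x) (f := f) (C := C)
      (Filter.Eventually.of_forall hC)
    simpa using this
  have hC2 : ∀ z, |f z ^ 2| ≤ C ^ 2 := fun z => by
    rw [abs_pow]; exact pow_le_pow_left₀ (abs_nonneg _) (hC z) 2
  have hF₂C : ∀ x, |F₂ x| ≤ C ^ 2 := fun x => by
    have := norm_integral_le_of_norm_le_const (μ := K x) (f := fun z => f z ^ 2) (C := C ^ 2)
      (Filter.Eventually.of_forall hC2)
    simpa using this
  have hF2C : ∀ x, |F x ^ 2| ≤ C ^ 2 := fun x => by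
    rw [abs_pow]; exact pow_le_pow_left₀ (abs_nonneg _) (hFC x) 2
  have iF : Integrable F μ := integrable_of_abs_le hFm hFC
  have iF2 : Integrable (fun x => F x ^ 2) μ := integrable_of_abs_le (by fun_prop) hF2C
  have iF₂ : Integrable F₂ μ := integrable_of_abs_le hF₂m hF₂C
  have hF₂0 : ∀ x, 0 ≤ F₂ x := fun x => integral_nonneg fun _ => sq_nonneg _
  have hΥ := Upsilon_nonneg ε
  rw [← integral_const_mul]
  -- If `F` keeps one sign, its zero mean makes it vanish almost everywhere. Otherwise both index
  -- sets in the separation argument below are nonempty.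
  by_cases hpos : ∃ x, 0 < F x
  swap
  · push Not at hpos
    have : F =ᵐ[μ] 0 := by
      have h1 : 0 ≤ᵐ[μ] -F := Filter.Eventually.of_forall fun x => by simpa using hpos x
      have h2 := (integral_eq_zero_iff_of_nonneg_ae h1 iF.neg).1 (by
        simp only [Pi.neg_apply, integral_neg, h0, neg_zero])
      filter_upwards [h2] with x hx
      simpa using hx
    refine integral_mono_ae iF2 (iF₂.const_mul _) ?_
    filter_upwards [this] with x hx
    have : F x = 0 := hx
    change F x ^ 2 ≤ Upsilon ε * F₂ x
    rw [this]
    simpa using mul_nonneg hΥ (hF₂0 x)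
  by_cases hneg : ∃ x, F x < 0
  swap
  · push Not at hneg
    have : F =ᵐ[μ] 0 := (integral_eq_zero_iff_of_nonneg hneg iF).1 h0
    refine integral_mono_ae iF2 (iF₂.const_mul _) ?_
    filter_upwards [this] with x hx
    have : F x = 0 := hx
    change F x ^ 2 ≤ Upsilon ε * F₂ x
    rw [this]
    simpa using mul_nonneg hΥ (hF₂0 x)
  -- The goal is a multiplier `l` with `F² ≤ Υ F₂ + l F` pointwise, for then integration removes the
  -- term `l F`. Such an `l` must lie above the quotients where `F > 0` and below those where `F <
  -- 0`.
  have sep : ∀ a ∈ (fun x => (F x ^ 2 - Upsilon ε * F₂ x) / F x) '' {x | 0 < F x},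
      ∀ b ∈ (fun x => (F x ^ 2 - Upsilon ε * F₂ x) / F x) '' {x | F x < 0}, a ≤ b := by
    rintro _ ⟨x, hx, rfl⟩ _ ⟨x', hx', rfl⟩
    simp only [Set.mem_ofPred_eq] at hx hx'
    -- These weights give `F` mean zero on the two points `x`, `x'`: the pairwise estimate is the
    -- two-point case of the contraction.
    have h := hK.mul_sq_sub_le hε hf hC x x' (α := -F x') (β := F x) (by linarith) hx.le
      (by linarith)
    simp only
    rw [← sub_nonneg]
    have e : (F x' ^ 2 - Upsilon ε * F₂ x') / F x' - (F x ^ 2 - Upsilon ε * F₂ x) / F x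
        = (Upsilon ε * (-F x' * F₂ x + F x * F₂ x') - -F x' * F x * (F x - F x')) /
          (F x * -F x') := by
      field_simp [hx'.ne]
      ring
    rw [e]
    refine div_nonneg (sub_nonneg.2 ?_) (mul_nonneg hx.le (by linarith))
    refine le_of_mul_le_mul_right ?_ (show 0 < F x - F x' by linarith)
    linear_combination h
  obtain ⟨l, hl1, hl2⟩ := exists_between_of_forall_le
    (Set.Nonempty.image _ hpos) (Set.Nonempty.image _ hneg) sep
  have hG : ∀ x, F x ^ 2 ≤ Upsilon ε * F₂ x + l * F x := fun x => by
    rcases lt_trichotomy (F x) 0 with h | h | h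
    · have := hl2 (Set.mem_image_of_mem _ h)
      rw [le_div_iff_of_neg h] at this
      linarith
    · rw [h]
      simpa using mul_nonneg hΥ (hF₂0 x)
    · have := hl1 (Set.mem_image_of_mem _ h)
      rw [div_le_iff₀ h] at this
      linarith
  have := integral_mono iF2 ((iF₂.const_mul (Upsilon ε)).add (iF.const_mul l)) hG
  simp only [Pi.add_apply] at this
  rw [integral_add (iF₂.const_mul _) (iF.const_mul _), integral_const_mul l, h0] at this
  simpa using this

end Contraction

/-! ### Closeness of the output laws in triangular discrimination. -/

section Outputs

variable {X Z : Type*} [MeasurableSpace X] [MeasurableSpace Z]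

lemma tvDist_eq {P Q : Measure X} {p : X → ℝ}
    (h1 : ∀ᵐ x ∂(P + Q), (P.rnDeriv (P + Q) x).toReal = p x)
    (h2 : ∀ᵐ x ∂(P + Q), (Q.rnDeriv (P + Q) x).toReal = 1 - p x) :
    tvDist P Q = (1 / 2) * ∫ x, |2 * p x - 1| ∂(P + Q) := by
  rw [tvDist]
  congr 1
  refine integral_congr_ae ?_
  filter_upwards [h1, h2] with x h1 h2
  rw [h1, h2]
  ring_nf

lemma hellingerSq_eq {P Q : Measure X} {p : X → ℝ}
    (h1 : ∀ᵐ x ∂(P + Q), (P.rnDeriv (P + Q) x).toReal = p x)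
    (h2 : ∀ᵐ x ∂(P + Q), (Q.rnDeriv (P + Q) x).toReal = 1 - p x) :
    hellingerSq P Q = ∫ x, (√(p x) - √(1 - p x)) ^ 2 ∂(P + Q) := by
  rw [hellingerSq]
  refine integral_congr_ae ?_
  filter_upwards [h1, h2] with x h1 h2
  rw [h1, h2]

lemma sq_two_mul_sub_one_le {p : ℝ} (h0 : 0 ≤ p) (h1 : p ≤ 1) :
    (2 * p - 1) ^ 2 ≤ 2 * (√p - √(1 - p)) ^ 2 := by
  have e1 := Real.sq_sqrt h0
  have e2 := Real.sq_sqrt (sub_nonneg.2 h1)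
  have : 2 * p - 1 = (√p - √(1 - p)) * (√p + √(1 - p)) := by linear_combination e2 - e1
  rw [this, mul_pow, mul_comm]
  refine mul_le_mul_of_nonneg_right ?_ (sq_nonneg _)
  nlinarith [sq_nonneg (√p - √(1 - p))]

lemma tvDist_nonneg (P Q : Measure X) : 0 ≤ tvDist P Q :=
  mul_nonneg (by norm_num) (integral_nonneg fun _ => abs_nonneg _)

/-- The output laws of an `ε`-LDP mechanism are close: their triangular discrimination
`∫ (r - s)² / (r + s)` is at most `2 Υ_ε H²(P, Q)` and at most `2 Ψ_ε TV(P, Q)²`. -/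
lemma IsLDPMechanism.exists_output_density {ε : ℝ} (hε : 0 ≤ ε) {K : Kernel X Z}
    (hK : IsLDPMechanism ε K) (P Q : Measure X) [IsProbabilityMeasure P] [IsProbabilityMeasure Q] :
    ∃ ρ : Z → ℝ, Measurable ρ ∧ (∀ z, 0 ≤ ρ z) ∧ (∀ z, ρ z ≤ 1) ∧
      P.bind K = (P.bind K + Q.bind K).withDensity (fun z => ENNReal.ofReal (ρ z)) ∧
      Q.bind K = (P.bind K + Q.bind K).withDensity (fun z => ENNReal.ofReal (1 - ρ z)) ∧
      ∫ z, (2 * ρ z - 1) ^ 2 ∂(P.bind K + Q.bind K) ≤ 2 * Upsilon ε * hellingerSq P Q ∧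
      ∫ z, (2 * ρ z - 1) ^ 2 ∂(P.bind K + Q.bind K) ≤ 2 * Psi ε * tvDist P Q ^ 2 := by
  have := hK.isMarkov
  obtain ⟨ρ, hρm, hρ0, hρ1, hPK, hQK, -, -⟩ := exists_density (P.bind K) (Q.bind K)
  refine ⟨ρ, hρm, hρ0, hρ1, hPK, hQK, ?_⟩
  obtain ⟨p, hpm, hp0, hp1, hP, hQ, hp, hq⟩ := exists_density P Q
  rw [tvDist_eq hp hq, hellingerSq_eq hp hq]
  set PK := P.bind K
  set QK := Q.bind K
  set ν := PK + QK with hν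
  set μ := P + Q with hμ
  -- The signed density of `PK - QK`, tested against itself: its second moment under `ν` is also its
  -- integral against `PK - QK`.
  set f : Z → ℝ := fun z => 2 * ρ z - 1 with hf
  have hfm : Measurable f := by fun_prop
  have hfC : ∀ z, |f z| ≤ 1 := fun z => abs_le.2 ⟨by linarith [hρ0 z], by linarith [hρ1 z]⟩
  have hC2 : ∀ z, |f z ^ 2| ≤ 1 := fun z => by
    rw [abs_pow]; exact pow_le_one₀ (abs_nonneg _) (hfC z)
  set F : X → ℝ := fun x => ∫ z, f z ∂(K x) with hF
  set F₂ : X → ℝ := fun x => ∫ z, f z ^ 2 ∂(K x) with hF₂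
  have hFm : Measurable F := (hfm.stronglyMeasurable.integral_kernel (κ := K)).measurable
  have hF₂m : Measurable F₂ :=
    ((hfm.pow_const 2).stronglyMeasurable.integral_kernel (κ := K)).measurable
  have hFC : ∀ x, |F x| ≤ 1 := fun x => by
    have := norm_integral_le_of_norm_le_const (μ := K x) (f := f) (C := 1)
      (Filter.Eventually.of_forall hfC)
    simpa using this
  have hF₂C : ∀ x, |F₂ x| ≤ 1 := fun x => by
    have := norm_integral_le_of_norm_le_const (μ := K x) (f := fun z => f z ^ 2) (C := 1)
      (Filter.Eventually.of_forall hC2)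
    simpa using this
  have hF₂0 : ∀ x, 0 ≤ F₂ x := fun x => integral_nonneg fun _ => sq_nonneg _
  have iF : ∀ (m : Measure X) [IsFiniteMeasure m], Integrable F m :=
    fun m _ => integrable_of_abs_le hFm hFC
  have iF₂ : ∀ (m : Measure X) [IsFiniteMeasure m], Integrable F₂ m :=
    fun m _ => integrable_of_abs_le hF₂m hF₂C
  have hpC : ∀ x, |2 * p x - 1| ≤ 1 := fun x => abs_le.2 ⟨by linarith [hp0 x], by linarith [hp1 x]⟩
  have ipg : ∀ {g : X → ℝ} {c : ℝ}, Measurable g → (∀ x, |g x| ≤ c) →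
      Integrable (fun x => (2 * p x - 1) * g x) μ := fun {g c} hg hc =>
    integrable_of_abs_le (C := c) (by fun_prop) fun x => by
      rw [abs_mul]
      nlinarith [abs_nonneg (2 * p x - 1), abs_nonneg (g x), hpC x, hc x]
  have bind_sub : ∀ {g : X → ℝ} {c : ℝ}, Measurable g → (∀ x, |g x| ≤ c) →
      (∫ x, g x ∂P) - ∫ x, g x ∂Q = ∫ x, (2 * p x - 1) * g x ∂μ := fun {g c} hg hc => by
    have hc' : ∀ r : ℝ, |r| ≤ 1 → ∀ x, |r * g x| ≤ c := fun r hr x => by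
      rw [abs_mul]
      nlinarith [abs_nonneg r, abs_nonneg (g x), hc x]
    have e1 : ∫ x, g x ∂P = ∫ x, p x * g x ∂μ := by
      conv_lhs => rw [hP]
      exact integral_withDensity_ofReal hpm hp0 g
    have e2 : ∫ x, g x ∂Q = ∫ x, (1 - p x) * g x ∂μ := by
      conv_lhs => rw [hQ]
      exact integral_withDensity_ofReal (by fun_prop) (fun x => sub_nonneg.2 (hp1 x)) g
    rw [e1, e2, ← integral_sub]
    · congr 1 with x
      ring
    · exact integrable_of_abs_le (by fun_prop) fun x =>
        hc' _ (abs_le.2 ⟨by linarith [hp0 x], hp1 x⟩) x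
    · exact integrable_of_abs_le (by fun_prop) fun x =>
        hc' _ (abs_le.2 ⟨by linarith [hp1 x], by linarith [hp0 x]⟩) x
  set L := ∫ z, f z ^ 2 ∂ν with hL
  have hL0 : 0 ≤ L := integral_nonneg fun _ => sq_nonneg _
  have hLF₂ : L = ∫ x, F₂ x ∂μ := by
    rw [hL, hν, integral_add_measure (integrable_of_abs_le (hfm.pow_const 2) hC2)
      (integrable_of_abs_le (hfm.pow_const 2) hC2), hμ, integral_add_measure (iF₂ P) (iF₂ Q),
      integral_bind_kernel P K (hfm.pow_const 2) hC2, integral_bind_kernel Q K (hfm.pow_const 2) hC2]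
  have hLF : L = ∫ x, (2 * p x - 1) * F x ∂μ := by
    rw [← bind_sub hFm hFC, ← integral_bind_kernel P K hfm hfC, ← integral_bind_kernel Q K hfm hfC]
    have e1 : ∫ z, f z ∂PK = ∫ z, ρ z * f z ∂ν := by
      conv_lhs => rw [hPK]
      exact integral_withDensity_ofReal hρm hρ0 f
    have e2 : ∫ z, f z ∂QK = ∫ z, (1 - ρ z) * f z ∂ν := by
      conv_lhs => rw [hQK]
      exact integral_withDensity_ofReal (by fun_prop) (fun x => sub_nonneg.2 (hρ1 x)) f
    change L = (∫ z, f z ∂PK) - ∫ z, f z ∂QK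
    rw [e1, e2, ← integral_sub]
    · rw [hL]
      congr 1 with z
      rw [hf]
      ring
    · refine integrable_of_abs_le (C := 1) (by fun_prop) fun z => ?_
      rw [abs_mul, abs_of_nonneg (hρ0 z)]
      exact mul_le_one₀ (hρ1 z) (abs_nonneg _) (hfC z)
    · refine integrable_of_abs_le (C := 1) (by fun_prop) fun z => ?_
      rw [abs_mul, abs_of_nonneg (sub_nonneg.2 (hρ1 z))]
      exact mul_le_one₀ (by linarith [hρ0 z]) (abs_nonneg _) (hfC z)
  have hp_zero : ∫ x, (2 * p x - 1) ∂μ = 0 := by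
    have := bind_sub (g := fun _ => (1 : ℝ)) (c := 1) measurable_const (by simp)
    simpa using this.symm
  -- `P - Q` has total mass zero, so `F` may be shifted by any constant: by its mean for the
  -- Hellinger bound, by a value `F x'` for the total variation bound.
  have hLc : ∀ c : ℝ, L = ∫ x, (2 * p x - 1) * (F x - c) ∂μ := fun c => by
    have e : ∀ x, (2 * p x - 1) * (F x - c) = (2 * p x - 1) * F x - (2 * p x - 1) * c :=
      fun x => by ring
    simp_rw [e]
    rw [integral_sub (ipg hFm hFC) (ipg measurable_const (fun _ => le_rfl)), integral_mul_const,
      hp_zero, hLF]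
    simp
  have hμ1 : μ.real Set.univ = 2 := by
    rw [hμ, measureReal_add_apply]; norm_num
  have hL_sq_le : ∀ {c : ℝ}, L ^ 2 ≤ c * L → 0 ≤ c → L ≤ c := fun {c} h hc => by
    rcases hL0.eq_or_lt with h0 | h0
    · rwa [← h0]
    · nlinarith
  constructor
  -- The mean of `F`; the 2 is the total mass of `μ = P + Q`.
  · set c := (∫ x, F x ∂μ) / 2 with hc
    have hfcm : Measurable fun z => f z - c := by fun_prop
    have hfcC : ∀ z, |f z - c| ≤ 1 + |c| := fun z => (abs_sub _ _).trans (by linarith [hfC z])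
    have if1 : ∀ x, Integrable f (K x) := fun x => integrable_of_abs_le hfm hfC
    have if2 : ∀ x, Integrable (fun z => f z ^ 2) (K x) := fun x =>
      integrable_of_abs_le (hfm.pow_const 2) hC2
    have e1 : ∀ x, ∫ z, (f z - c) ∂(K x) = F x - c := fun x => by
      rw [integral_sub (if1 x) (integrable_const c)]
      simp [hF]
    have e2 : ∀ x, ∫ z, (f z - c) ^ 2 ∂(K x) = F₂ x - 2 * c * F x + c ^ 2 := fun x => by
      have : ∀ z, (f z - c) ^ 2 = f z ^ 2 - 2 * c * f z + c ^ 2 := fun z => by ring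
      simp_rw [this]
      have i : Integrable (fun z => f z ^ 2 - 2 * c * f z) (K x) :=
        (if2 x).sub ((if1 x).const_mul _)
      rw [integral_add i (integrable_const _), integral_sub (if2 x) ((if1 x).const_mul _), integral_const_mul]
      simp [hF, hF₂]
    have h := hK.integral_sq_le hε hfcm hfcC μ (by
      simp_rw [e1]
      rw [integral_sub (iF μ) (integrable_const c)]
      simp [hμ1, hc]
      ring)
    simp_rw [e1, e2] at h
    have e3 : ∫ x, (F₂ x - 2 * c * F x + c ^ 2) ∂μ = L - 2 * c ^ 2 := by
      have i : Integrable (fun x => F₂ x - 2 * c * F x) μ := (iF₂ μ).sub ((iF μ).const_mul _)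
      rw [integral_add i (integrable_const _), integral_sub (iF₂ μ) ((iF μ).const_mul _), integral_const_mul, ← hLF₂,
        show ∫ x, F x ∂μ = 2 * c by rw [hc]; ring]
      simp [hμ1]
      ring
    rw [e3] at h
    have hΥ := Upsilon_nonneg ε
    have h2 : ∫ x, (F x - c) ^ 2 ∂μ ≤ Upsilon ε * L :=
      h.trans (mul_le_mul_of_nonneg_left (by nlinarith [sq_nonneg c]) hΥ)
    have hFcC : ∀ x, |F x - c| ≤ 1 + |c| := fun x => (abs_sub _ _).trans (by linarith [hFC x])
    have cs := sq_integral_mul_le (μ := μ) (f := fun x => 2 * p x - 1) (g := fun x => F x - c)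
      (integrable_of_abs_le (C := 1) (by fun_prop) fun x => by
        rw [abs_pow]; exact pow_le_one₀ (abs_nonneg _) (hpC x))
      (integrable_of_abs_le (C := (1 + |c|) ^ 2) (by fun_prop) fun x => by
        rw [abs_pow]; exact pow_le_pow_left₀ (abs_nonneg _) (hFcC x) 2)
      (ipg (by fun_prop) hFcC)
    rw [← hLc c] at cs
    have h3 : ∫ x, (2 * p x - 1) ^ 2 ∂μ ≤ 2 * ∫ x, (√(p x) - √(1 - p x)) ^ 2 ∂μ := by
      rw [← integral_const_mul]
      refine integral_mono (integrable_of_abs_le (C := 1) (by fun_prop) fun x => ?_)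
        (Integrable.const_mul (integrable_of_abs_le (C := 1) (by fun_prop) fun x => ?_) _)
        fun x => sq_two_mul_sub_one_le (hp0 x) (hp1 x)
      · rw [abs_pow]; exact pow_le_one₀ (abs_nonneg _) (hpC x)
      · rw [abs_pow]
        refine pow_le_one₀ (abs_nonneg _) (abs_le.2 ⟨?_, ?_⟩)
        · linarith [Real.sqrt_nonneg (p x), Real.sqrt_le_one.2 (by linarith [hp0 x] : 1 - p x ≤ 1)]
        · linarith [Real.sqrt_nonneg (1 - p x), Real.sqrt_le_one.2 (hp1 x)]
    have hH0 : 0 ≤ ∫ x, (√(p x) - √(1 - p x)) ^ 2 ∂μ := integral_nonneg fun _ => sq_nonneg _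
    refine hL_sq_le ?_ (by positivity)
    calc L ^ 2 ≤ _ := cs
      _ ≤ (2 * ∫ x, (√(p x) - √(1 - p x)) ^ 2 ∂μ) * (Upsilon ε * L) :=
        mul_le_mul h3 h2 (integral_nonneg fun _ => sq_nonneg _) (by positivity)
      _ = _ := by ring
  · set T := ∫ x, |2 * p x - 1| ∂μ with hT
    have hΨ := Psi_nonneg ε
    have hT0 : 0 ≤ T := integral_nonneg fun _ => abs_nonneg _
    have key : ∀ x', L ^ 2 ≤ T ^ 2 * (Psi ε * F₂ x') := fun x' => by
      have hb : ∀ x, |F x - F x'| ≤ √(Psi ε * F₂ x') := fun x =>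
        Real.abs_le_sqrt (hK.sq_sub_le hε hfm hfC x x')
      have h1 : |L| ≤ T * √(Psi ε * F₂ x') := by
        rw [hLc (F x'), hT, ← integral_mul_const]
        refine (abs_integral_le_integral_abs).trans (integral_mono
          (ipg (hFm.sub_const _) hb).abs ((integrable_of_abs_le (C := 1) (by fun_prop)
            fun x => by rw [abs_abs]; exact hpC x).mul_const _) fun x => ?_)
        simp only
        rw [abs_mul]
        exact mul_le_mul_of_nonneg_left (hb x) (abs_nonneg _)
      have h2 := pow_le_pow_left₀ (abs_nonneg L) h1 2
      rwa [sq_abs, mul_pow, Real.sq_sqrt (mul_nonneg hΨ (hF₂0 x'))] at h2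
    -- Averaging over the reference point `x'` turns `F₂ x'` back into `L`, giving `2 L² ≤ T² Ψ L`
    -- with `T = 2 TV`; one factor `L` then cancels.
    have h := integral_mono (μ := μ) (integrable_const (L ^ 2))
      (((iF₂ μ).const_mul (Psi ε)).const_mul (T ^ 2)) key
    rw [integral_const_mul, integral_const_mul, ← hLF₂] at h
    simp only [integral_const, hμ1, smul_eq_mul] at h
    refine hL_sq_le ?_ (by positivity)
    linarith

end Outputs

/-! ### Hellinger affinity: coarsening, tensorization, and comparison with triangular
discrimination. -/

section Affinity

variable {Ω : Type*} [MeasurableSpace Ω]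

lemma measureReal_withDensity_ofReal {ν : Measure Ω} [IsFiniteMeasure ν] {r : Ω → ℝ}
    (hr : Measurable r) (hr0 : ∀ x, 0 ≤ r x) (hr1 : ∀ x, r x ≤ 1) {A : Set Ω}
    (hA : MeasurableSet A) :
    (ν.withDensity fun x => ENNReal.ofReal (r x)).real A = ∫ x in A, r x ∂ν := by
  have hi : Integrable r (ν.restrict A) := integrable_of_abs_le (C := 1) hr fun x => by
    rw [abs_of_nonneg (hr0 x)]; exact hr1 x
  rw [measureReal_def, withDensity_apply _ hA,
    ← ofReal_integral_eq_lintegral_ofReal hi (Filter.Eventually.of_forall hr0),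
    ENNReal.toReal_ofReal (integral_nonneg hr0)]

lemma integral_sqrt_mul_le_sqrt {ν : Measure Ω} [IsFiniteMeasure ν] {r s : Ω → ℝ}
    (hr : Measurable r) (hr0 : ∀ x, 0 ≤ r x) (hr1 : ∀ x, r x ≤ 1)
    (hs : Measurable s) (hs0 : ∀ x, 0 ≤ s x) (hs1 : ∀ x, s x ≤ 1) :
    ∫ x, √(r x * s x) ∂ν ≤ √((∫ x, r x ∂ν) * ∫ x, s x ∂ν) := by
  refine Real.le_sqrt_of_sq_le ?_
  have ir : Integrable r ν := integrable_of_abs_le (C := 1) hr fun x => by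
    rw [abs_of_nonneg (hr0 x)]; exact hr1 x
  have is : Integrable s ν := integrable_of_abs_le (C := 1) hs fun x => by
    rw [abs_of_nonneg (hs0 x)]; exact hs1 x
  have h := sq_integral_mul_le (μ := ν) (f := fun x => √(r x)) (g := fun x => √(s x))
    (by simpa only [Real.sq_sqrt (hr0 _)] using ir) (by simpa only [Real.sq_sqrt (hs0 _)] using is)
    (integrable_of_abs_le (C := 1) (by fun_prop) fun x => by
      rw [abs_of_nonneg (by positivity)]
      exact mul_le_one₀ (Real.sqrt_le_one.2 (hr1 x)) (Real.sqrt_nonneg _)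
        (Real.sqrt_le_one.2 (hs1 x)))
  simpa only [Real.sq_sqrt (hr0 _), Real.sq_sqrt (hs0 _), ← Real.sqrt_mul (hr0 _)] using h

/-- Monotonicity of the Hellinger affinity under the coarsening given by an event. -/
lemma integral_sqrt_mul_le {ν : Measure Ω} [IsFiniteMeasure ν] {r s : Ω → ℝ}
    (hr : Measurable r) (hr0 : ∀ x, 0 ≤ r x) (hr1 : ∀ x, r x ≤ 1)
    (hs : Measurable s) (hs0 : ∀ x, 0 ≤ s x) (hs1 : ∀ x, s x ≤ 1)
    {R S : Measure Ω} [IsProbabilityMeasure R] [IsProbabilityMeasure S]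
    (hR : R = ν.withDensity fun x => ENNReal.ofReal (r x))
    (hS : S = ν.withDensity fun x => ENNReal.ofReal (s x)) {A : Set Ω} (hA : MeasurableSet A) :
    ∫ x, √(r x * s x) ∂ν ≤ √(R.real A * S.real A) + √((1 - R.real A) * (1 - S.real A)) := by
  have i : Integrable (fun x => √(r x * s x)) ν := by
    refine integrable_of_abs_le (C := 1) (by fun_prop) fun x => ?_
    rw [abs_of_nonneg (Real.sqrt_nonneg _)]
    exact Real.sqrt_le_one.2 (mul_le_one₀ (hr1 x) (hs0 x) (hs1 x))
  rw [← integral_add_compl hA i, ← probReal_compl_eq_one_sub hA, ← probReal_compl_eq_one_sub hA]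
  have eR : ∀ B, MeasurableSet B → R.real B = ∫ x in B, r x ∂ν := fun B hB => by
    rw [hR]; exact measureReal_withDensity_ofReal hr hr0 hr1 hB
  have eS : ∀ B, MeasurableSet B → S.real B = ∫ x in B, s x ∂ν := fun B hB => by
    rw [hS]; exact measureReal_withDensity_ofReal hs hs0 hs1 hB
  rw [eR A hA, eS A hA, eR _ hA.compl, eS _ hA.compl]
  exact add_le_add (integral_sqrt_mul_le_sqrt hr hr0 hr1 hs hs0 hs1)
    (integral_sqrt_mul_le_sqrt hr hr0 hr1 hs hs0 hs1)

lemma pi_withDensity_ofReal {ι : Type*} [Fintype ι] {ν : ι → Measure Ω}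
    [∀ i, IsFiniteMeasure (ν i)] {r : ι → Ω → ℝ} (hr : ∀ i, Measurable (r i))
    (hr0 : ∀ i x, 0 ≤ r i x) (hr1 : ∀ i x, r i x ≤ 1) :
    Measure.pi (fun i => (ν i).withDensity fun x => ENNReal.ofReal (r i x)) =
      (Measure.pi ν).withDensity fun z => ENNReal.ofReal (∏ i, r i (z i)) := by
  have hfin : ∀ i, IsFiniteMeasure ((ν i).withDensity fun x => ENNReal.ofReal (r i x)) := fun i =>
    isFiniteMeasure_withDensity_ofReal
      (integrable_of_abs_le (C := 1) (hr i) fun x => by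
        rw [abs_of_nonneg (hr0 i x)]; exact hr1 i x).2
  have hm : Measurable fun z : ι → Ω => ∏ i, r i (z i) :=
    Finset.measurable_prod _ fun i _ => (hr i).comp (measurable_pi_apply i)
  have h0 : ∀ z : ι → Ω, 0 ≤ ∏ i, r i (z i) := fun z => Finset.prod_nonneg fun i _ => hr0 i _
  have h1 : ∀ z : ι → Ω, ∏ i, r i (z i) ≤ 1 := fun z =>
    Finset.prod_le_one (fun i _ => hr0 i _) fun i _ => hr1 i _
  have : IsFiniteMeasure ((Measure.pi ν).withDensity fun z => ENNReal.ofReal (∏ i, r i (z i))) :=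
    isFiniteMeasure_withDensity_ofReal
      (integrable_of_abs_le (C := 1) hm fun x => by rw [abs_of_nonneg (h0 x)]; exact h1 x).2
  refine Measure.pi_eq fun s hs => ?_
  rw [← ENNReal.toReal_eq_toReal_iff' (measure_ne_top _ _)
    (ENNReal.prod_ne_top fun i _ => measure_ne_top _ _), ENNReal.toReal_prod]
  change Measure.real _ _ = ∏ i, Measure.real _ _
  rw [measureReal_withDensity_ofReal hm h0 h1 (MeasurableSet.univ_pi hs), Measure.restrict_pi_pi,
    integral_fintype_prod_eq_prod]
  exact Finset.prod_congr rfl fun i _ =>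
    (measureReal_withDensity_ofReal (hr i) (hr0 i) (hr1 i) (hs i)).symm

lemma integral_sqrt_prod_mul_prod {ι : Type*} [Fintype ι] {ν : ι → Measure Ω}
    [∀ i, IsFiniteMeasure (ν i)] {r s : ι → Ω → ℝ}
    (hr0 : ∀ i x, 0 ≤ r i x) (hs0 : ∀ i x, 0 ≤ s i x) :
    ∫ z, √((∏ i, r i (z i)) * ∏ i, s i (z i)) ∂(Measure.pi ν) =
      ∏ i, ∫ x, √(r i x * s i x) ∂(ν i) := by
  rw [← integral_fintype_prod_eq_prod]
  refine integral_congr_ae (Filter.Eventually.of_forall fun z => ?_)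
  simp only
  rw [← Finset.prod_mul_distrib, Real.sqrt_prod _ fun i _ => mul_nonneg (hr0 i _) (hs0 i _)]

/-- Since `u = √(ρ(1 - ρ)) ≤ 1 / 2`, one has `u ≥ 2u² = (1 - (2ρ - 1)²) / 2`; then integrate against
total mass 2. -/
lemma one_sub_half_le_affinity {R S : Measure Ω} [IsProbabilityMeasure R] [IsProbabilityMeasure S]
    {ρ : Ω → ℝ} (hρ : Measurable ρ) (hρ0 : ∀ x, 0 ≤ ρ x) (hρ1 : ∀ x, ρ x ≤ 1) :
    1 - (∫ x, (2 * ρ x - 1) ^ 2 ∂(R + S)) / 2 ≤ ∫ x, √(ρ x * (1 - ρ x)) ∂(R + S) := by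
  have h1 : (R + S).real Set.univ = 2 := by
    rw [measureReal_add_apply]; norm_num
  have i1 : Integrable (fun x => (2 * ρ x - 1) ^ 2) (R + S) :=
    integrable_of_abs_le (C := 1) (by fun_prop) fun x => by
      rw [abs_pow]
      exact pow_le_one₀ (abs_nonneg _) (abs_le.2 ⟨by linarith [hρ0 x], by linarith [hρ1 x]⟩)
  have e : 1 - (∫ x, (2 * ρ x - 1) ^ 2 ∂(R + S)) / 2 =
      ∫ x, (1 / 2 - 1 / 2 * (2 * ρ x - 1) ^ 2) ∂(R + S) := by
    rw [integral_sub (integrable_const _) (i1.const_mul _), integral_const_mul]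
    simp [h1]
    ring
  rw [e]
  refine integral_mono ((integrable_const _).sub (i1.const_mul _))
    (integrable_of_abs_le (C := 1) (by fun_prop) fun x => ?_) fun x => ?_
  · rw [abs_of_nonneg (Real.sqrt_nonneg _)]
    exact Real.sqrt_le_one.2 (mul_le_one₀ (hρ1 x) (sub_nonneg.2 (hρ1 x)) (by linarith [hρ0 x]))
  · refine Real.le_sqrt_of_sq_le ?_
    have : 0 ≤ ρ x * (1 - ρ x) := mul_nonneg (hρ0 x) (sub_nonneg.2 (hρ1 x))
    nlinarith [sq_nonneg (2 * ρ x - 1)]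

/-- Weighted AM–GM, with weights making it an equality at the extreme case `a = 1 / 10`, `b = 9 /
10`, where the affinity is exactly `3 / 5`. -/
lemma sqrt_add_sqrt_lt {a b : ℝ} (ha0 : 0 ≤ a) (ha : a < 1 / 10) (hb : 1 - b < 1 / 10)
    (hb1 : b ≤ 1) : √(a * b) + √((1 - a) * (1 - b)) < 3 / 5 := by
  have h1 : √(a * b) ≤ (9 * a + b) / 6 := by
    refine Real.sqrt_le_iff.2 ⟨by linarith, ?_⟩
    nlinarith [sq_nonneg (9 * a - b)]
  have h2 : √((1 - a) * (1 - b)) ≤ ((1 - a) + 9 * (1 - b)) / 6 := by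
    refine Real.sqrt_le_iff.2 ⟨by linarith, ?_⟩
    nlinarith [sq_nonneg ((1 - a) - 9 * (1 - b))]
  linarith

end Affinity

/-! ### Lower bound on the number of samples. -/

section LowerBound

variable {X Z : Type*} [MeasurableSpace X] [MeasurableSpace Z]

/-- The number of samples needed by a good test, if the affinity of each pair of output laws is at
least `1 - l / 2`. -/
lemma le_mul_of_prod_lt {n : ℕ} {b : Fin n → ℝ} {l : ℝ} (hb : ∀ i, 1 - l / 2 ≤ b i)
    (h : ∏ i, b i < 3 / 5) : 4 / 5 ≤ n * l := by
  by_contra! hn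
  rcases Nat.eq_zero_or_pos n with rfl | hpos
  · norm_num at h
  have hn1 : (1 : ℝ) ≤ n := by exact_mod_cast hpos
  -- This keeps `1 - l / 2` nonnegative, so that the product dominates its `n`-th power.
  have hl : l ≤ 4 / 5 := by nlinarith
  have h1 : (1 - l / 2) ^ n ≤ ∏ i, b i := by
    have := Finset.prod_le_prod (s := Finset.univ) (f := fun _ : Fin n => 1 - l / 2) (g := b)
      (fun _ _ => by linarith) fun i _ => hb i
    simpa using this
  have h2 := one_add_mul_le_pow (a := -(l / 2)) (by linarith) n
  rw [← sub_eq_add_neg] at h2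
  linarith

lemma ErrorsSmall.le_mul {ε : ℝ} (hε : 0 ≤ ε) {P Q : Measure X} [IsProbabilityMeasure P]
    [IsProbabilityMeasure Q] {K : ℕ → Kernel X Z} (hK : ∀ i, IsLDPMechanism ε (K i)) {n : ℕ}
    {φ : (Fin n → Z) → Bool} (hφ : Measurable φ) (h : ErrorsSmall P Q K n φ) :
    4 / 5 ≤ n * (2 * Upsilon ε * hellingerSq P Q) ∧
      4 / 5 ≤ n * (2 * Psi ε * tvDist P Q ^ 2) := by
  have hM : ∀ i, IsMarkovKernel (K i) := fun i => (hK i).isMarkov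
  choose ρ hρm hρ0 hρ1 hR hS h1 h2 using fun i : Fin n => (hK i).exists_output_density hε P Q
  have hq0 : ∀ i x, 0 ≤ 1 - ρ i x := fun i x => sub_nonneg.2 (hρ1 i x)
  have hq1 : ∀ i x, 1 - ρ i x ≤ 1 := fun i x => by linarith [hρ0 i x]
  have hqm : ∀ i, Measurable fun x => 1 - ρ i x := fun i => measurable_const.sub (hρm i)
  set ν : Fin n → Measure Z := fun i => P.bind (K i) + Q.bind (K i) with hν
  have hRn : outputLaw P K n =
      (Measure.pi ν).withDensity fun z => ENNReal.ofReal (∏ i, ρ i (z i)) := by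
    rw [← pi_withDensity_ofReal hρm hρ0 hρ1, outputLaw]
    exact congrArg Measure.pi (funext hR)
  have hSn : outputLaw Q K n =
      (Measure.pi ν).withDensity fun z => ENNReal.ofReal (∏ i, (1 - ρ i (z i))) := by
    rw [← pi_withDensity_ofReal hqm hq0 hq1, outputLaw]
    exact congrArg Measure.pi (funext hS)
  have : IsProbabilityMeasure (outputLaw P K n) := by unfold outputLaw; infer_instance
  have : IsProbabilityMeasure (outputLaw Q K n) := by unfold outputLaw; infer_instance
  have hA : MeasurableSet {z | φ z = true} := hφ (measurableSet_singleton true)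
  have hm : ∀ {r : Fin n → Z → ℝ}, (∀ i, Measurable (r i)) →
      Measurable fun z : Fin n → Z => ∏ i, r i (z i) := fun hr =>
    Finset.measurable_prod _ fun i _ => (hr i).comp (measurable_pi_apply i)
  have haff := integral_sqrt_mul_le (hm hρm)
    (fun z => Finset.prod_nonneg fun i _ => hρ0 i (z i))
    (fun z => Finset.prod_le_one (fun i _ => hρ0 i (z i)) fun i _ => hρ1 i (z i))
    (hm hqm) (fun z => Finset.prod_nonneg fun i _ => hq0 i (z i))
    (fun z => Finset.prod_le_one (fun i _ => hq0 i (z i)) fun i _ => hq1 i (z i)) hRn hSn hA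
  rw [integral_sqrt_prod_mul_prod hρ0 hq0] at haff
  have hlt := haff.trans_lt (sqrt_add_sqrt_lt measureReal_nonneg h.1 h.2 measureReal_le_one)
  exact ⟨le_mul_of_prod_lt (fun i => (by linarith [h1 i] : _ ≤ _).trans
      (one_sub_half_le_affinity (hρm i) (hρ0 i) (hρ1 i))) hlt,
    le_mul_of_prod_lt (fun i => (by linarith [h2 i] : _ ≤ _).trans
      (one_sub_half_le_affinity (hρm i) (hρ0 i) (hρ1 i))) hlt⟩

lemma log_five_halves_le_one : Real.log 2.5 ≤ 1 := by
  rw [Real.log_le_iff_le_exp (by norm_num)]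
  linarith [Real.exp_one_gt_d9]

lemma div_ofReal_le_natCast {c d : ℝ} {n : ℕ} (hc : 0 < c) (h : c ≤ n * d) :
    ENNReal.ofReal c / ENNReal.ofReal d ≤ n := by
  have hd : 0 < d := by
    by_contra! hd
    have := mul_nonpos_of_nonneg_of_nonpos (Nat.cast_nonneg (α := ℝ) n) hd
    linarith
  refine ENNReal.div_le_of_le_mul ?_
  rw [← ENNReal.ofReal_natCast, ← ENNReal.ofReal_mul (Nat.cast_nonneg n)]
  exact ENNReal.ofReal_le_ofReal h

lemma ErrorsSmall.lowerBound_le {ε : ℝ} (hε : 0 ≤ ε) {P Q : Measure X} [IsProbabilityMeasure P]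
    [IsProbabilityMeasure Q] {K : ℕ → Kernel X Z} (hK : ∀ i, IsLDPMechanism ε (K i)) {n : ℕ}
    {φ : (Fin n → Z) → Bool} (hφ : Measurable φ) (h : ErrorsSmall P Q K n φ) :
    lowerBound ε P Q ≤ n := by
  obtain ⟨h1, h2⟩ := h.le_mul hε hK hφ
  refine max_le (div_ofReal_le_natCast (Real.log_pos (by norm_num)) ?_) ?_
  -- There is room to spare: `n * (4 Υ H²) ≥ 8 / 5`, while only `log 2.5 ≤ 1` is needed.
  · linarith [log_five_halves_le_one]
  · rw [show (2 : ℝ≥0∞) = ENNReal.ofReal 2 by simp]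
    exact div_ofReal_le_natCast (by norm_num) (by linarith)

lemma le_toENNReal_testSampleComplexity {L : ℝ≥0∞} {P Q : Measure X} {K : ℕ → Kernel X Z}
    {φ : (n : ℕ) → (Fin n → Z) → Bool} (h : ∀ n, ErrorsSmall P Q K n (φ n) → L ≤ n) :
    L ≤ (testSampleComplexity P Q K φ : ℝ≥0∞) := by
  rw [testSampleComplexity]
  simp only [ENat.toENNReal_iInf]
  exact le_iInf₂ fun N hN => by simpa using h N (hN N le_rfl)

end LowerBound

lemma lowerBound_le_sampleComplexity {X : Type u} [MeasurableSpace X] {ε : ℝ} (hε : 0 ≤ ε)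
    (P Q : Measure X) [IsProbabilityMeasure P] [IsProbabilityMeasure Q] :
    lowerBound ε P Q ≤ (sampleComplexity.{u, v} ε P Q : ℝ≥0∞) := by
  rw [sampleComplexity]
  simp only [ENat.toENNReal_iInf, le_iInf_iff]
  exact fun Z _ K hK φ hφ => le_toENNReal_testSampleComplexity fun n hn =>
    hn.lowerBound_le hε hK (hφ n)

lemma sampleComplexity_le_commonSampleComplexity {X : Type u} [MeasurableSpace X] (ε : ℝ)
    (P Q : Measure X) : sampleComplexity.{u, v} ε P Q ≤ commonSampleComplexity.{u, v} ε P Q := by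
  simp only [commonSampleComplexity, le_iInf_iff]
  exact fun Z _ K hK φ hφ =>
    iInf_le_of_le Z <| iInf_le_of_le _ <| iInf_le_of_le (fun _ => K) <|
      iInf_le_of_le (fun _ => hK) <| iInf_le_of_le φ <| iInf_le_of_le hφ le_rfl

/-! ### Posterior randomized tests and their realization by a uniform variable. -/

section RandomizedTest

variable {W : Type*} [MeasurableSpace W]

lemma mul_div_add_le_sqrt {r s : ℝ} (hr : 0 ≤ r) (hs : 0 ≤ s) :
    r * (s / (r + s)) ≤ √(r * s) / 2 := by
  rcases (add_nonneg hr hs).eq_or_lt with h | h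
  · rw [← h, div_zero, mul_zero]
    positivity
  rw [← mul_div_assoc, div_le_iff₀ h]
  have e := Real.sq_sqrt (mul_nonneg hr hs)
  have h2 : 2 * √(r * s) ≤ r + s := by
    have : √(r * s) ≤ (r + s) / 2 :=
      Real.sqrt_le_iff.2 ⟨by linarith, by nlinarith [sq_nonneg (r - s)]⟩
    linarith
  nlinarith [Real.sqrt_nonneg (r * s)]

/-- Two probability measures are distinguished by the posterior randomized test, with both errors
at most half the Hellinger affinity. -/
lemma exists_randomized_test {ν : Measure W} [IsFiniteMeasure ν] {r s : W → ℝ}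
    (hr : Measurable r) (hr0 : ∀ x, 0 ≤ r x) (hr1 : ∀ x, r x ≤ 1)
    (hs : Measurable s) (hs0 : ∀ x, 0 ≤ s x) (hs1 : ∀ x, s x ≤ 1)
    {R S : Measure W} [IsProbabilityMeasure S]
    (hR : R = ν.withDensity fun x => ENNReal.ofReal (r x))
    (hS : S = ν.withDensity fun x => ENNReal.ofReal (s x)) :
    ∃ G : W → ℝ, Measurable G ∧ (∀ x, 0 ≤ G x) ∧ (∀ x, G x ≤ 1) ∧
      ∫ x, G x ∂(R) ≤ (∫ x, √(r x * s x) ∂ν) / 2 ∧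
      1 - ∫ x, G x ∂S ≤ (∫ x, √(r x * s x) ∂ν) / 2 := by
  have hG0 : ∀ x, 0 ≤ s x / (r x + s x) := fun x =>
    div_nonneg (hs0 x) (add_nonneg (hr0 x) (hs0 x))
  have hG1 : ∀ x, s x / (r x + s x) ≤ 1 := fun x =>
    div_le_one_of_le₀ (by linarith [hr0 x]) (add_nonneg (hr0 x) (hs0 x))
  have i : Integrable (fun x => √(r x * s x) / 2) ν := by
    refine integrable_of_abs_le (C := 1) (by fun_prop) fun x => ?_
    rw [abs_of_nonneg (by positivity)]
    have := Real.sqrt_le_one.2 (mul_le_one₀ (hr1 x) (hs0 x) (hs1 x))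
    linarith
  have is : Integrable s ν := integrable_of_abs_le (C := 1) hs fun x => by
    rw [abs_of_nonneg (hs0 x)]; exact hs1 x
  have ir : Integrable (fun x => r x * (s x / (r x + s x))) ν :=
    integrable_of_abs_le (C := 1) (by fun_prop) fun x => by
      rw [abs_of_nonneg (mul_nonneg (hr0 x) (hG0 x))]
      exact mul_le_one₀ (hr1 x) (hG0 x) (hG1 x)
  have is' : Integrable (fun x => s x * (s x / (r x + s x))) ν :=
    integrable_of_abs_le (C := 1) (by fun_prop) fun x => by
      rw [abs_of_nonneg (mul_nonneg (hs0 x) (hG0 x))]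
      exact mul_le_one₀ (hs1 x) (hG0 x) (hG1 x)
  have hbound : ∫ x, r x * (s x / (r x + s x)) ∂ν ≤ (∫ x, √(r x * s x) ∂ν) / 2 := by
    rw [← integral_div]
    exact integral_mono ir i fun x => mul_div_add_le_sqrt (hr0 x) (hs0 x)
  -- Rejecting with the posterior probability of `S` under equal priors makes both errors equal to
  -- `∫ rs / (r + s)`. A deterministic likelihood ratio test would in general bound only their sum
  -- by the affinity.
  refine ⟨fun x => s x / (r x + s x), by fun_prop, hG0, hG1, ?_, ?_⟩
  · rw [hR, integral_withDensity_ofReal hr hr0]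
    exact hbound
  · have e1 : ∫ x, s x ∂ν = 1 := by
      have := integral_withDensity_ofReal (ν := ν) hs hs0 fun _ => 1
      rw [← hS] at this
      simpa using this.symm
    have e2 : ∫ x, s x / (r x + s x) ∂S = ∫ x, s x * (s x / (r x + s x)) ∂ν := by
      conv_lhs => rw [hS]
      exact integral_withDensity_ofReal hs hs0 _
    rw [e2, ← e1, ← integral_sub is is']
    refine le_trans (le_of_eq ?_) hbound
    congr 1 with x
    rcases (add_nonneg (hr0 x) (hs0 x)).eq_or_lt with h | h
    · have : s x = 0 := by linarith [hr0 x, hs0 x]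
      simp [this]
    · field_simp
      ring

/-- The uniform distribution on the unit interval. -/
noncomputable def unif : Measure ℝ := volume.restrict (Set.Icc 0 1)

instance : IsProbabilityMeasure unif := ⟨by simp [unif]⟩

lemma unif_Iic {g : ℝ} (h1 : g ≤ 1) : unif (Set.Iic g) = ENNReal.ofReal g := by
  have : Set.Iic g ∩ Set.Icc 0 1 = Set.Icc 0 g := by
    ext u
    simp only [Set.mem_inter_iff, Set.mem_Iic, Set.mem_Icc]
    exact ⟨fun h => ⟨h.2.1, h.1⟩, fun h => ⟨h.2, h.1, h.2.trans h1⟩⟩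
  rw [unif, Measure.restrict_apply measurableSet_Iic, this, Real.volume_Icc, sub_zero]

/-- A randomized test is realized by a deterministic one that uses an independent uniform
variable. -/
lemma pi_prod_unif_real_le {n : ℕ} (i₀ : Fin n) (ρ : Measure W) [IsProbabilityMeasure ρ]
    {G : (Fin n → W) → ℝ} (hG : Measurable G) (hG0 : ∀ w, 0 ≤ G w) (hG1 : ∀ w, G w ≤ 1) :
    (Measure.pi fun _ : Fin n => ρ.prod unif).real
      {z | (z i₀).2 ≤ G fun i => (z i).1} = ∫ w, G w ∂(Measure.pi fun _ => ρ) := by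
  have hmp := measurePreserving_arrowProdEquivProdArrow W ℝ (Fin n) (fun _ => ρ) fun _ => unif
  have hT : MeasurableSet {z : (Fin n → W) × (Fin n → ℝ) | z.2 i₀ ≤ G z.1} :=
    measurableSet_le (by fun_prop) (by fun_prop)
  have h := hmp.measure_preimage hT.nullMeasurableSet
  have hsec : ∀ w : Fin n → W, (Measure.pi fun _ : Fin n => unif)
      (Prod.mk w ⁻¹' {z : (Fin n → W) × (Fin n → ℝ) | z.2 i₀ ≤ G z.1}) =
        ENNReal.ofReal (G w) := fun w => by
    have h' := (measurePreserving_eval (fun _ : Fin n => unif) i₀).measure_preimage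
      (measurableSet_Iic (a := G w)).nullMeasurableSet
    rw [unif_Iic (hG1 w)] at h'
    exact h'
  rw [Measure.prod_apply hT] at h
  simp_rw [hsec] at h
  rw [integral_eq_lintegral_of_nonneg_ae (Filter.Eventually.of_forall hG0)
    hG.aestronglyMeasurable, ← h]
  rfl

end RandomizedTest

/-! ### Randomized response and the upper bound. -/

section UpperBound

variable {X W : Type*} [MeasurableSpace X] [MeasurableSpace W]

lemma bind_prod_const (P : Measure X) [IsProbabilityMeasure P] (K : Kernel X W) [IsMarkovKernel K]
    (m : Measure ℝ) [IsProbabilityMeasure m] :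
    P.bind (K ×ₖ Kernel.const X m) = (P.bind K).prod m := by
  ext s hs
  rw [Measure.bind_apply hs (Kernel.aemeasurable _), Measure.prod_apply hs,
    Measure.lintegral_bind (Kernel.aemeasurable _) (measurable_measure_prodMk_left hs).aemeasurable]
  refine lintegral_congr fun x => ?_
  rw [Kernel.prod_apply' _ _ _ hs]
  rfl

/-- The appended noise does not depend on the input, so the domination of `K x` by `e^ε K x'`
survives integration of the sections of `A`. -/
lemma IsLDPMechanism.prod_const {ε : ℝ} {K : Kernel X W} (hK : IsLDPMechanism ε K)
    (m : Measure ℝ) [IsProbabilityMeasure m] :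
    IsLDPMechanism ε (K ×ₖ Kernel.const X m) := by
  have := hK.isMarkov
  refine ⟨inferInstance, fun A hA x x' => ?_⟩
  rw [Kernel.prod_apply' _ _ _ hA, Kernel.prod_apply' _ _ _ hA]
  simp only [Kernel.const_apply]
  have hle : K x ≤ ENNReal.ofReal (Real.exp ε) • K x' :=
    Measure.le_iff.2 fun s hs => by simpa using hK.ldp s hs x x'
  calc _ ≤ ∫⁻ b, m (Prod.mk b ⁻¹' A) ∂(ENNReal.ofReal (Real.exp ε) • K x') :=
        lintegral_mono' hle le_rfl
    _ = _ := lintegral_smul_measure _ _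

/-- After expanding the square, AM–GM bounds the cross term by `a(1 - a) + b(1 - b)`, and the total
is exactly `1 - (a - b)²`. -/
lemma sq_sqrt_add_sqrt_le {a b : ℝ} (ha0 : 0 ≤ a) (ha1 : a ≤ 1) (hb0 : 0 ≤ b) (hb1 : b ≤ 1) :
    (√(a * b) + √((1 - a) * (1 - b))) ^ 2 ≤ 1 - (a - b) ^ 2 := by
  have e1 := Real.sq_sqrt (mul_nonneg ha0 hb0)
  have e2 := Real.sq_sqrt (mul_nonneg (sub_nonneg.2 ha1) (sub_nonneg.2 hb1))
  have h : √(a * b) * √((1 - a) * (1 - b)) ≤ (a * (1 - a) + b * (1 - b)) / 2 := by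
    rw [← Real.sqrt_mul (mul_nonneg ha0 hb0)]
    have h1 := mul_nonneg ha0 (sub_nonneg.2 ha1)
    have h2 := mul_nonneg hb0 (sub_nonneg.2 hb1)
    exact Real.sqrt_le_iff.2 ⟨by linarith, by nlinarith [sq_nonneg (a * (1 - a) - b * (1 - b))]⟩
  nlinarith

/-- `n` observations suffice if some event is sufficiently informative under the mechanism. -/
lemma exists_test_of_event {P Q : Measure X} [IsProbabilityMeasure P] [IsProbabilityMeasure Q]
    {K : Kernel X W} [IsMarkovKernel K] {B : Set W} (hB : MeasurableSet B) {n : ℕ} (hn : 0 < n)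
    (h : (1 - ((P.bind K).real B - (Q.bind K).real B) ^ 2) ^ n < 1 / 25) :
    ∃ φ : (Fin n → W × ℝ) → Bool, Measurable φ ∧
      ErrorsSmall P Q (fun _ => K ×ₖ Kernel.const X unif) n φ := by
  obtain ⟨ρ, hρm, hρ0, hρ1, hR, hS, -, -⟩ := exists_density (P.bind K) (Q.bind K)
  have hq0 : ∀ x, 0 ≤ 1 - ρ x := fun x => sub_nonneg.2 (hρ1 x)
  have hq1 : ∀ x, 1 - ρ x ≤ 1 := fun x => by linarith [hρ0 x]
  have hqm : Measurable fun x => 1 - ρ x := measurable_const.sub hρm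
  have haff := integral_sqrt_mul_le hρm hρ0 hρ1 hqm hq0 hq1 hR hS hB
  set PK := P.bind K
  set QK := Q.bind K
  set ν := PK + QK with hν
  set b := ∫ x, √(ρ x * (1 - ρ x)) ∂ν with hb
  have hb0 : 0 ≤ b := integral_nonneg fun _ => Real.sqrt_nonneg _
  have hb2 : b ^ 2 ≤ 1 - (PK.real B - QK.real B) ^ 2 :=
    (pow_le_pow_left₀ hb0 haff 2).trans (sq_sqrt_add_sqrt_le measureReal_nonneg measureReal_le_one
      measureReal_nonneg measureReal_le_one)
  have hbn : b ^ n < 1 / 5 := by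
    have h1 : (b ^ n) ^ 2 < (1 / 5) ^ 2 := by
      rw [← pow_mul, mul_comm, pow_mul]
      exact (pow_le_pow_left₀ (sq_nonneg b) hb2 n).trans_lt (h.trans_eq (by norm_num))
    exact lt_of_pow_lt_pow_left₀ 2 (by norm_num) h1
  have hRn : (Measure.pi fun _ : Fin n => PK) =
      (Measure.pi fun _ => ν).withDensity fun z => ENNReal.ofReal (∏ i, ρ (z i)) := by
    rw [← pi_withDensity_ofReal (r := fun _ => ρ) (fun _ => hρm) (fun _ => hρ0) fun _ => hρ1]
    exact congrArg Measure.pi (funext fun _ => hR)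
  have hSn : (Measure.pi fun _ : Fin n => QK) =
      (Measure.pi fun _ => ν).withDensity fun z => ENNReal.ofReal (∏ i, (1 - ρ (z i))) := by
    rw [← pi_withDensity_ofReal (r := fun _ x => 1 - ρ x) (fun _ => hqm) (fun _ => hq0) fun _ => hq1]
    exact congrArg Measure.pi (funext fun _ => hS)
  have hm : ∀ {r : W → ℝ}, Measurable r → Measurable fun z : Fin n → W => ∏ i, r (z i) :=
    fun hr => Finset.measurable_prod _ fun i _ => hr.comp (measurable_pi_apply i)
  obtain ⟨G, hGm, hG0, hG1, hG2, hG3⟩ := exists_randomized_test (hm hρm)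
    (fun z => Finset.prod_nonneg fun i _ => hρ0 (z i))
    (fun z => Finset.prod_le_one (fun i _ => hρ0 (z i)) fun i _ => hρ1 (z i))
    (hm hqm) (fun z => Finset.prod_nonneg fun i _ => hq0 (z i))
    (fun z => Finset.prod_le_one (fun i _ => hq0 (z i)) fun i _ => hq1 (z i)) hRn hSn
  rw [integral_sqrt_prod_mul_prod (ν := fun _ => ν) (r := fun _ => ρ) (s := fun _ x => 1 - ρ x)
    (fun _ => hρ0) (fun _ => hq0), Finset.prod_const, Finset.card_fin, ← hb] at hG2 hG3
  have hT : MeasurableSet {z : Fin n → W × ℝ | (z ⟨0, hn⟩).2 ≤ G fun i => (z i).1} :=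
    measurableSet_le (by fun_prop) (hGm.comp (by fun_prop))
  classical
  refine ⟨fun z => decide ((z ⟨0, hn⟩).2 ≤ G fun i => (z i).1), ?_, ?_, ?_⟩
  · refine measurable_to_bool ?_
    convert hT using 1
    ext z
    simp
  · simp only [outputLaw, bind_prod_const, decide_eq_true_eq]
    rw [pi_prod_unif_real_le _ _ hGm hG0 hG1]
    linarith
  · simp only [outputLaw, bind_prod_const, decide_eq_true_eq]
    rw [pi_prod_unif_real_le _ _ hGm hG0 hG1]
    linarith

lemma exists_measurableSet_sub_eq_tvDist (P Q : Measure X) [IsProbabilityMeasure P]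
    [IsProbabilityMeasure Q] : ∃ A, MeasurableSet A ∧ P.real A - Q.real A = tvDist P Q := by
  obtain ⟨p, hpm, hp0, hp1, hP, hQ, hp, hq⟩ := exists_density P Q
  rw [tvDist_eq hp hq]
  set μ := P + Q
  have hA : MeasurableSet {x | 0 ≤ 2 * p x - 1} := measurableSet_le measurable_const (by fun_prop)
  -- The event is `{p ≥ q}`. Since `P - Q` has mass zero, the event and its complement contribute
  -- equally to `∫ |p - q|`, which cancels the factor `1 / 2`.
  refine ⟨_, hA, ?_⟩
  have ip : ∀ m : Measure X, [IsFiniteMeasure m] → Integrable p m := fun m _ =>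
    integrable_of_abs_le (C := 1) hpm fun x => by rw [abs_of_nonneg (hp0 x)]; exact hp1 x
  have sub_eq : ∀ B, MeasurableSet B → P.real B - Q.real B = ∫ x in B, (2 * p x - 1) ∂μ :=
      fun B hB => by
    have e1 : P.real B = ∫ x in B, p x ∂μ := by
      conv_lhs => rw [hP]
      exact measureReal_withDensity_ofReal hpm hp0 hp1 hB
    have e2 : Q.real B = ∫ x in B, (1 - p x) ∂μ := by
      conv_lhs => rw [hQ]
      exact measureReal_withDensity_ofReal (by fun_prop) (fun x => sub_nonneg.2 (hp1 x))
        (fun x => by linarith [hp0 x]) hB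
    have i : Integrable (fun x => 1 - p x) (μ.restrict B) := (integrable_const _).sub (ip _)
    rw [e1, e2, ← integral_sub (ip _) i]
    congr 1 with x
    ring
  have i2 : Integrable (fun x => 2 * p x - 1) μ := ((ip μ).const_mul 2).sub (integrable_const _)
  have e1 : ∫ x in {x | 0 ≤ 2 * p x - 1}, |2 * p x - 1| ∂μ
      = ∫ x in {x | 0 ≤ 2 * p x - 1}, (2 * p x - 1) ∂μ :=
    setIntegral_congr_fun hA fun x hx => abs_of_nonneg hx
  have e2 : ∫ x in {x | 0 ≤ 2 * p x - 1}ᶜ, |2 * p x - 1| ∂μ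
      = ∫ x in {x | 0 ≤ 2 * p x - 1}ᶜ, -(2 * p x - 1) ∂μ :=
    setIntegral_congr_fun hA.compl fun x hx => abs_of_neg (not_le.1 hx)
  rw [← integral_add_compl hA i2.abs, e1, e2, integral_neg, ← sub_eq _ hA, ← sub_eq _ hA.compl,
    probReal_compl_eq_one_sub hA, probReal_compl_eq_one_sub hA]
  ring

/-- Randomized response: the answer to `x ∈ A` is reported correctly with probability
`e^ε / (1 + e^ε)`. -/
lemma exists_randomizedResponse {ε : ℝ} (hε : 0 ≤ ε) {A : Set X} (hA : MeasurableSet A) :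
    ∃ (K : Kernel X (ULift.{v} Bool)) (B : Set (ULift.{v} Bool)),
      IsLDPMechanism ε K ∧ MeasurableSet B ∧
      ∀ (P Q : Measure X) [IsProbabilityMeasure P] [IsProbabilityMeasure Q],
        (P.bind K).real B - (Q.bind K).real B =
          (Real.exp ε - 1) / (Real.exp ε + 1) * (P.real A - Q.real A) := by
  set y := Real.exp ε with hy
  have hy1 : 1 ≤ y := Real.one_le_exp hε
  have hB : MeasurableSet (ULift.down.{v} ⁻¹' {true}) :=
    measurable_down (measurableSet_singleton true)
  set c := y / (y + 1) with hc
  have hc' : 1 - c = 1 / (y + 1) := by rw [hc]; field_simp; ring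
  have hc0 : 0 ≤ c := by positivity
  have hc1 : 0 ≤ 1 - c := by rw [hc']; positivity
  set m : ℝ → Measure (ULift.{v} Bool) := fun u => ENNReal.ofReal u • Measure.dirac ⟨true⟩ +
    ENNReal.ofReal (1 - u) • Measure.dirac ⟨false⟩ with hm
  have hmB : ∀ u, m u (ULift.down ⁻¹' {true}) = ENNReal.ofReal u := fun u => by
    simp [hm, Measure.dirac_apply' _ hB]
  have hm_le : ∀ {u u' : ℝ}, 0 ≤ y → u ≤ y * u' → 1 - u ≤ y * (1 - u') →
      ∀ s, m u s ≤ ENNReal.ofReal y * m u' s := fun {u u'} h0 h1 h2 s => by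
    simp only [hm, Measure.add_apply, Measure.smul_apply, smul_eq_mul, mul_add, ← mul_assoc,
      ← ENNReal.ofReal_mul h0]
    gcongr
  have hm_prob : ∀ {u : ℝ}, 0 ≤ u → 0 ≤ 1 - u → IsProbabilityMeasure (m u) := fun h1 h2 =>
    ⟨by simp [hm, ← ENNReal.ofReal_add h1 h2]⟩
  have := hm_prob hc0 hc1
  have : IsProbabilityMeasure (m (1 - c)) := hm_prob hc1 (by linarith)
  classical
  set K : Kernel X (ULift.{v} Bool) :=
    Kernel.piecewise hA (Kernel.const X (m c)) (Kernel.const X (m (1 - c))) with hK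
  have b1 : c ≤ y * (1 - c) := by rw [hc', hc, mul_one_div]
  have b2 : 1 - c ≤ y * c := by
    rw [hc', hc, ← mul_div_assoc]
    gcongr
    nlinarith
  have b3 : c ≤ y * c := by nlinarith
  have b4 : 1 - c ≤ y * (1 - c) := by nlinarith
  have hKm : IsMarkovKernel K := by rw [hK]; infer_instance
  refine ⟨K, ULift.down ⁻¹' {true}, ⟨hKm, fun s _ x x' => ?_⟩, hB, fun P Q _ _ => ?_⟩
  · rw [hK, Kernel.piecewise_apply, Kernel.piecewise_apply]
    simp only [Kernel.const_apply]
    have h0 : 0 ≤ y := by linarith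
    split_ifs
    · exact hm_le h0 b3 b4 s
    · exact hm_le h0 b1 (by linarith) s
    · exact hm_le h0 b2 (by linarith) s
    · exact hm_le h0 b4 (by linarith) s
  · have key : ∀ (P : Measure X) [IsProbabilityMeasure P],
        (P.bind K).real (ULift.down ⁻¹' {true}) = c * P.real A + (1 - c) * (1 - P.real A) :=
        fun P _ => by
      have e : ∀ x, K x (ULift.down ⁻¹' {true}) =
          A.indicator (fun _ => ENNReal.ofReal c) x +
            Aᶜ.indicator (fun _ => ENNReal.ofReal (1 - c)) x := fun x => by
        rw [hK, Kernel.piecewise_apply]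
        by_cases hx : x ∈ A <;> simp [hx, hmB]
      rw [measureReal_def, Measure.bind_apply hB (Kernel.aemeasurable _)]
      simp_rw [e]
      rw [lintegral_add_left (measurable_const.indicator hA), lintegral_indicator_const hA,
        lintegral_indicator_const hA.compl, ENNReal.toReal_add
          (ENNReal.mul_ne_top ENNReal.ofReal_ne_top (measure_ne_top _ _))
          (ENNReal.mul_ne_top ENNReal.ofReal_ne_top (measure_ne_top _ _)),
        ENNReal.toReal_mul, ENNReal.toReal_mul, ENNReal.toReal_ofReal hc0,
        ENNReal.toReal_ofReal hc1, ← measureReal_def, ← measureReal_def,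
        probReal_compl_eq_one_sub hA]
    rw [key P, key Q]
    have : (y - 1) / (y + 1) = c - (1 - c) := by rw [hc', hc]; ring
    rw [this]
    ring

lemma one_lt_log_five : 1 < Real.log 5 := by
  rw [Real.lt_log_iff_exp_lt (by norm_num)]
  linarith [Real.exp_one_lt_d9]

/-- The hypothesis allows `n` to fall short of `2 log 5 / s` by almost 1, as rounding down requires.
The second-order gain in `-log (1 - s) ≥ s / (1 - s / 2)` makes up for this loss because `log 5 >
1`. -/
lemma one_sub_pow_lt {s : ℝ} (hs0 : 0 < s) (hs1 : s < 1) {n : ℕ}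
    (hn : 2 * Real.log 5 / s < n + 1) : (1 - s) ^ n < 1 / 25 := by
  have h1s : 0 < 1 - s := by linarith
  have hlog : 2 * s / (2 - s) ≤ -Real.log (1 - s) := by
    have h := Real.le_log_one_add_of_nonneg (x := s / (1 - s)) (by positivity)
    have e1 : 1 + s / (1 - s) = (1 - s)⁻¹ := by field_simp; ring
    have e2 : 2 * (s / (1 - s)) / (s / (1 - s) + 2) = 2 * s / (2 - s) := by
      have : 2 - s ≠ 0 := by linarith
      have : s / (1 - s) + 2 = (2 - s) / (1 - s) := by field_simp; ring
      rw [this]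
      field_simp
    rwa [e1, e2, Real.log_inv] at h
  have hc := one_lt_log_five
  rw [div_lt_iff₀ hs0] at hn
  have h2 : 2 * Real.log 5 < n * (2 * s / (2 - s)) := by
    rw [← mul_div_assoc, lt_div_iff₀ (by linarith)]
    nlinarith
  have h3 : n * Real.log (1 - s) < -(2 * Real.log 5) := by
    nlinarith [mul_le_mul_of_nonneg_left hlog (Nat.cast_nonneg (α := ℝ) n)]
  rw [← Real.log_lt_log_iff (by positivity) (by norm_num), Real.log_pow, one_div, Real.log_inv,
    show (25 : ℝ) = 5 ^ 2 by norm_num, Real.log_pow]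
  exact_mod_cast h3

lemma tvDist_le_one (P Q : Measure X) [IsProbabilityMeasure P] [IsProbabilityMeasure Q] :
    tvDist P Q ≤ 1 := by
  obtain ⟨A, -, h⟩ := exists_measurableSet_sub_eq_tvDist P Q
  rw [← h]
  linarith [measureReal_le_one (μ := P) (s := A), measureReal_nonneg (μ := Q) (s := A)]

lemma Upsilon_lt_one {ε : ℝ} (hε : 0 ≤ ε) : Upsilon ε < 1 := by
  have hy : 1 ≤ Real.exp ε := Real.one_le_exp hε
  rw [Upsilon, sq_lt_one_iff₀ (div_nonneg (by linarith) (by linarith)), div_lt_one (by linarith)]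
  linarith

end UpperBound

lemma commonSampleComplexity_le_upperBound {X : Type u} [MeasurableSpace X] {ε : ℝ} (hε : 0 ≤ ε)
    (P Q : Measure X) [IsProbabilityMeasure P] [IsProbabilityMeasure Q] :
    (commonSampleComplexity.{u, v} ε P Q : ℝ≥0∞) ≤ upperBound ε P Q := by
  have hlog := one_lt_log_five
  have hΥ := Upsilon_nonneg ε
  rw [upperBound]
  set s := Upsilon ε * tvDist P Q ^ 2 with hs
  have hs0 : 0 ≤ s := by positivity
  rcases hs0.eq_or_lt with h0 | h0
  · rw [← h0, ENNReal.ofReal_zero, ENNReal.div_zero (by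
      rw [Ne, ENNReal.ofReal_eq_zero, not_le]; linarith)]
    exact le_top
  have hs1 : s < 1 :=
    (mul_le_of_le_one_right hΥ (pow_le_one₀ (tvDist_nonneg P Q) (tvDist_le_one P Q))).trans_lt
      (Upsilon_lt_one hε)
  rw [← ENNReal.ofReal_div_of_pos h0]
  -- Rounded down, not up: the real upper bound must dominate the integer `N` itself.
  set N := ⌊2 * Real.log 5 / s⌋₊ with hN
  obtain ⟨A, hA, htv⟩ := exists_measurableSet_sub_eq_tvDist P Q
  obtain ⟨K, B, hK, hB, hdiff⟩ := exists_randomizedResponse.{v} hε hA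
  have := hK.isMarkov
  have hsq : ((P.bind K).real B - (Q.bind K).real B) ^ 2 = s := by
    rw [hdiff, htv, hs, mul_pow, Upsilon]
  -- At least one observation is needed, since the test takes its coin from the first output.
  have hN1 : 1 ≤ N := by
    refine Nat.le_floor ?_
    rw [Nat.cast_one, le_div_iff₀ h0]
    linarith
  have htest : ∀ n : ℕ, ∃ φ : (Fin n → ULift.{v} Bool × ℝ) → Bool, Measurable φ ∧
      (N ≤ n → ErrorsSmall P Q (fun _ => K ×ₖ Kernel.const X unif) n φ) := fun n => by
    by_cases hn : N ≤ n
    · obtain ⟨φ, h1, h2⟩ := exists_test_of_event (P := P) (Q := Q) (K := K) hB (n := n) (by lia) (by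
        rw [hsq]
        refine one_sub_pow_lt h0 hs1 ((Nat.lt_floor_add_one _).trans_le ?_)
        rw [← hN]
        exact_mod_cast Nat.add_le_add_right hn 1)
      exact ⟨φ, h1, fun _ => h2⟩
    · exact ⟨fun _ => true, measurable_const, fun h => absurd h hn⟩
  choose φ hφm hφ using htest
  have hle : commonSampleComplexity.{u, v} ε P Q ≤ (N : ℕ∞) :=
    iInf_le_of_le (ULift.{v} Bool × ℝ) <| iInf_le_of_le inferInstance <|
      iInf_le_of_le (K ×ₖ Kernel.const X unif) <| iInf_le_of_le (hK.prod_const unif) <|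
      iInf_le_of_le φ <| iInf_le_of_le hφm <| iInf₂_le_of_le N hφ le_rfl
  refine (ENat.toENNReal_le.2 hle).trans ?_
  rw [ENat.toENNReal_coe, ← ENNReal.ofReal_natCast]
  exact ENNReal.ofReal_le_ofReal (Nat.floor_le (by positivity))

end LDP

theorem lemma2 {X : Type u} [MeasurableSpace X] (P Q : Measure X)
    [IsProbabilityMeasure P] [IsProbabilityMeasure Q] (ε : ℝ) (hε : 0 ≤ ε) :
    (LDP.lowerBound ε P Q ≤ (LDP.sampleComplexity.{u, v} ε P Q : ℝ≥0∞) ∧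
      (LDP.sampleComplexity.{u, v} ε P Q : ℝ≥0∞) ≤ LDP.upperBound ε P Q) ∧
    (LDP.lowerBound ε P Q ≤ (LDP.commonSampleComplexity.{u, v} ε P Q : ℝ≥0∞) ∧
      (LDP.commonSampleComplexity.{u, v} ε P Q : ℝ≥0∞) ≤ LDP.upperBound ε P Q) := by
  have h1 := LDP.lowerBound_le_sampleComplexity.{u, v} hε P Q
  have h2 := LDP.commonSampleComplexity_le_upperBound.{u, v} hε P Q
  have h3 := ENat.toENNReal_le.2 (LDP.sampleComplexity_le_commonSampleComplexity.{u, v} ε P Q)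
  exact ⟨⟨h1, h3.trans h2⟩, h1.trans h3, h2⟩
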